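/- **Theorem (Euclidean $n$-gon).** For a bounded domain $M\subset\mathbb{R}^2$ let $\mathcal{A}(M)$ be the family of all non-empty open sets $\Omega\subseteq M$ with piecewise smooth boundary, that is, whose boundary $\partial\Omega$ is a finite union of embedded compact smooth regular arcs, any two of which meet at most in common end points. For $\Omega\in\mathcal{A}(M)$ put $$\eta^\partial(\Omega)=\frac{|\partial\Omega\cap M|}{|\partial\Omega\cap\partial M|},$$ where $|\cdot|$ denotes length, with $\eta^\partial(\Omega)=\infty$ if $|\partial\Omega\cap\partial M|=0$. The $k$-th Escobar constant of $M$ is $$I_k(M)=\inf\ \max_{1\le j\le k}\eta^\partial(\Omega_j),$$ the infimum being over all $k$-tuples $(\Omega_1,\dots,\Omega_k)$ of mutually disjoint members of $\mathcal{A}(M)$. Let $\mathbb{D}$ be the open unit disk in $\mathbb{R}^2$. Let $n\ge 3$ and let $M\subset\mathbb{R}^2$ be a Euclidean $n$-gon, i.e. the bounded domain enclosed by a simple closed polygon with $n$ vertices, with interior angles $0<\theta_1\le\theta_2\le\dots\le\theta_n<2\pi$ at its vertices. Then $$I_k(M)\le\sin(\theta_1/2)\le\cos(\pi/n)\qquad\text{for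 all } k\ge 3.$$ In particular, for $k\ge 3$, $I_k(M)\le I_k(\mathbb{D})$ whenever $k\ge n$ or $n\le 4$. -/

import Mathlib

open Set MeasureTheory
open scoped ENNReal ContDiff

/-- The Euclidean plane. -/
abbrev Plane : Type := EuclideanSpace ℝ (Fin 2)

/-- The length of a subset of the plane (one-dimensional Hausdorff measure, which for a rectifiable
curve is its Euclidean length). -/
noncomputable def planeLength (S : Set Plane) : ℝ≥0∞ := μH[1] S

/-- `γ` restricted to `[0, 1]` is a compact embedded smooth arc: smooth up to the end points,
regular and injective. -/
structure IsSmoothArc (γ : ℝ → Plane) : Prop where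
  contDiff : ContDiff ℝ ∞ γ
  deriv_ne_zero : ∀ t ∈ Icc (0 : ℝ) 1, deriv γ t ≠ 0
  injOn : InjOn γ (Icc 0 1)

/-- A set has piecewise smooth boundary if its topological boundary is a finite union of embedded
smooth arcs, two of which meet at most in common end points. -/
def HasPiecewiseSmoothBoundary (Ω : Set Plane) : Prop :=
  ∃ (m : ℕ) (γ : Fin m → ℝ → Plane),
    (∀ i, IsSmoothArc (γ i)) ∧
    (∀ i j, i ≠ j → Disjoint (γ i '' Ioo 0 1) (γ j '' Icc 0 1)) ∧
    frontier Ω = ⋃ i, γ i '' Icc 0 1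

/-- The family `𝒜(M)` of non-empty open subsets of `M` with piecewise smooth boundary. -/
structure IsAdmissible (M Ω : Set Plane) : Prop where
  isOpen : IsOpen Ω
  nonempty : Ω.Nonempty
  subset : Ω ⊆ M
  boundary : HasPiecewiseSmoothBoundary Ω

/-- The interior boundary `∂Ω ∩ M` of `Ω ⊆ M`. -/
def interiorBoundary (M Ω : Set Plane) : Set Plane := frontier Ω ∩ M

/-- The exterior boundary `∂Ω ∩ ∂M` of `Ω ⊆ M`. -/
def exteriorBoundary (M Ω : Set Plane) : Set Plane := frontier Ω ∩ frontier M

open Classical in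
/-- The isoperimetric ratio `|∂Ω ∩ M| / |∂Ω ∩ ∂M|`, equal to `∞` if the exterior boundary is empty
or, more generally, has length zero. -/
noncomputable def isoperimetricRatio (M Ω : Set Plane) : ℝ≥0∞ :=
  if planeLength (exteriorBoundary M Ω) = 0 then ⊤
  else planeLength (interiorBoundary M Ω) / planeLength (exteriorBoundary M Ω)

/-- The `k`-th Escobar constant of `M`: the infimum, over all `k`-tuples of mutually disjoint
members of `𝒜(M)`, of the largest isoperimetric ratio in the tuple. -/
noncomputable def escobarConstant (k : ℕ) (M : Set Plane) : ℝ≥0∞ :=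
  ⨅ (Ω : Fin k → Set Plane) (_ : (∀ j, IsAdmissible M (Ω j)) ∧
      Pairwise fun i j => Disjoint (Ω i) (Ω j)),
    ⨆ j, isoperimetricRatio M (Ω j)

/-- A closed polygon with at least three vertices is simple if its vertices are distinct,
consecutive edges meet exactly in their common vertex and all other pairs of distinct edges are
disjoint. The edge number `i` joins the vertices number `i` and `finRotate n i` (which is `i + 1`
taken cyclically). -/
structure IsSimplePolygon {n : ℕ} (P : Polygon Plane n) : Prop where
  three_le : 3 ≤ n
  injective : Function.Injective P.vertices
  adjacent : ∀ i, P.edgeSet ℝ i ∩ P.edgeSet ℝ (finRotate n i) = {P (finRotate n i)}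
  nonadjacent : ∀ i j, i ≠ j → finRotate n i ≠ j → finRotate n j ≠ i →
    Disjoint (P.edgeSet ℝ i) (P.edgeSet ℝ j)

/-- `M` is the (open) Euclidean `n`-gon with boundary polygon `P`: the bounded domain whose
boundary is the simple closed polygon `P`. -/
structure IsEuclideanPolygon {n : ℕ} (P : Polygon Plane n) (M : Set Plane) : Prop where
  simple : IsSimplePolygon P
  isOpen : IsOpen M
  isConnected : IsConnected M
  isBounded : Bornology.IsBounded M
  frontier_eq : frontier M = P.boundary ℝ

/-- The interior angle of `M` at `p`, in radians: the measure of the set of directions that point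
from `p` into `M`. -/
noncomputable def interiorAngle (M : Set Plane) (p : Plane) : ℝ :=
  (volume {φ : ℝ | φ ∈ Ioc (-Real.pi) Real.pi ∧
    ∃ r > 0, ∀ s ∈ Ioo (0 : ℝ) r, p + s • !₂[Real.cos φ, Real.sin φ] ∈ M}).toReal

/-- The open unit disk centred at the origin. -/
def unitDisk : Set Plane := Metric.ball 0 1

/-! Upper bound for the polygon. At a vertex the domain contains a sector, of angle ω say, with both
legs on the boundary. For ω < π, the isosceles trapezoid cut from it by legs running from distance b
to distance c has bases of total length 2(b + c) sin(ω/2) and legs of total length 2(c - b). Its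
ratio is therefore at most sin(ω/2)(c + b)/(c - b), which tends to sin(ω/2) as b/c → 0. Scales in
geometric progression give any number of disjoint trapezoids (`escobarConstant_le_of_sector`). At a
vertex of least interior angle θ₁ one has ω ≤ θ₁ < π.

The bound θ₁ ≤ π - 2π/n, equivalent to sin(θ₁/2) ≤ cos(π/n), is obtained without the angle sum. Each
direction is maximized over the vertices at some vertex, so some vertex collects outer normals of
total measure at least 2π/n. The directions into M there lie in the polar of these normals, which
has measure at most π - 2π/n (`IsEuclideanPolygon.exists_interiorAngle_le`).

Lower bound for the disk. Among k disjoint sets one has exterior boundary ℓ ≤ 2π/k, because almost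
no boundary point is shared. Its interior boundary is at least the chord 2 sin(ℓ/2)
(`IsArcFrontier.two_mul_sin_le_length`). For the latter, outside the circle of radius a the length
element dominates a|dθ| + √(1 - a²/r²)|dr|. If the frontier crosses the radii of angular measure ℓ
beyond radius a, and meets every larger circle twice, its length is at least aℓ plus twice the
radial integral; the tangent line of the sine at arccos a turns this into 2 sin(ℓ/2). A suitable a
lies just below the infimum of the radii beyond which all circles are met twice: some circle further
out than a is met at most once, and this forces the crossings. It remains to compare x cos(π/n) with
sin x on [0, π/k]. -/

open Filter Topology

/-! ### Speed integrals, Hausdorff length and multiplicity -/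

/-- A preconnected set that meets an open set but not its frontier lies in the open set. -/
theorem IsPreconnected.subset_of_disjoint_frontier {X : Type*} [TopologicalSpace X] {s u : Set X}
    (hs : IsPreconnected s) (hu : IsOpen u) (hd : Disjoint s (frontier u))
    (hne : (s ∩ u).Nonempty) : s ⊆ u := by
  refine hs.subset_of_closure_inter_subset hu hne ?_
  rintro x ⟨hx, hxs⟩
  by_contra hxu
  exact hd.le_bot ⟨hxs, by rw [hu.frontier_eq]; exact ⟨hx, hxu⟩⟩

/-- A curve on a convex set of parameters with nearly constant velocity does not shrink sets by much
more than its speed. -/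
theorem mul_volume_le_hausdorffMeasure_image {E : Type*} [NormedAddCommGroup E]
    [NormedSpace ℝ E] [MeasurableSpace E] [BorelSpace E] {γ : ℝ → E} (hγ : Differentiable ℝ γ)
    {J A : Set ℝ} (hJ : Convex ℝ J) (hA : A ⊆ J) (v : E) (ε : NNReal)
    (hv : ∀ x ∈ J, ‖deriv γ x - v‖ ≤ ε) :
    ‖v‖ₑ * volume A ≤ μH[1] (γ '' A) + ε * volume A := by
  have hlip : ∀ x ∈ J, ∀ y ∈ J, (‖v‖ - ε) * ‖y - x‖ ≤ ‖γ y - γ x‖ := by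
    intro x hx y hy
    -- Removing the uniform motion leaves an ε-Lipschitz curve, so γ expands distances by at least
    -- the factor ‖v‖ - ε; the inverse is then Lipschitz, which bounds Hausdorff measure from below.
    have h1 : ‖(γ y - y • v) - (γ x - x • v)‖ ≤ ε * ‖y - x‖ := by
      refine hJ.norm_image_sub_le_of_norm_hasDerivWithin_le
        (f := fun z => γ z - z • v) (f' := fun z => deriv γ z - v) ?_ hv hx hy
      intro z _
      have := ((hγ z).hasDerivAt.sub ((hasDerivAt_id z).smul_const v)).hasDerivWithinAt (s := J)
      rw [one_smul] at this
      exact this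
    have h2 : ‖(y - x) • v‖ = ‖v‖ * ‖y - x‖ := by rw [norm_smul, mul_comm]
    have h3 : (y - x) • v = (γ y - γ x) - ((γ y - y • v) - (γ x - x • v)) := by
      rw [sub_smul]; abel
    have h4 := norm_sub_le (γ y - γ x) ((γ y - y • v) - (γ x - x • v))
    rw [← h3, h2] at h4
    linarith
  rcases le_or_gt ‖v‖ (ε : ℝ) with h | h
  · refine le_trans ?_ le_add_self
    gcongr
    rw [← ofReal_norm]
    exact (ENNReal.ofReal_le_ofReal h).trans (by simp)
  · obtain ⟨K, hK⟩ : ∃ K : NNReal, (K : ℝ) = ‖v‖ - ε := ⟨⟨‖v‖ - ε, by linarith⟩, rfl⟩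
    have hK0 : K ≠ 0 := by
      rintro rfl
      rw [NNReal.coe_zero] at hK
      linarith
    rw [← hK] at hlip
    have hanti : AntilipschitzWith K⁻¹ (fun a : A => γ a) := by
      refine AntilipschitzWith.of_le_mul_dist fun x y => ?_
      have := hlip y (hA y.2) x (hA x.2)
      rw [← dist_eq_norm, ← dist_eq_norm] at this
      rw [NNReal.coe_inv, ← div_eq_inv_mul, le_div_iff₀ (NNReal.coe_pos.2 (pos_iff_ne_zero.2 hK0)),
        mul_comm]
      exact this
    have h5 := hanti.le_hausdorffMeasure_image zero_le_one univ
    rw [image_univ, ENNReal.rpow_one] at h5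
    have h6 : μH[1] (univ : Set A) = volume A := by
      have := (isometry_subtype_coe (s := A)).hausdorffMeasure_image
        (Or.inl zero_le_one) (univ : Set A)
      rw [← this, image_univ, Subtype.range_coe, hausdorffMeasure_real]
    have h7 : range (fun a : A => γ a) = γ '' A := by
      rw [image_eq_range]
    rw [h6, h7, ENNReal.coe_inv hK0] at h5
    have h8 : (K : ℝ≥0∞) * volume A ≤ μH[1] (γ '' A) := by
      calc (K : ℝ≥0∞) * volume A ≤ K * ((K : ℝ≥0∞)⁻¹ * μH[1] (γ '' A)) := by gcongr
        _ = _ := by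
          rw [← mul_assoc, ENNReal.mul_inv_cancel (by simpa using hK0) (by simp), one_mul]
    have h9 : ‖v‖ₑ = K + ε := by
      have : ‖v‖₊ = K + ε := by
        ext; simp [hK]
      rw [enorm_eq_nnnorm, this, ENNReal.coe_add]
    rw [h9, add_mul]
    gcongr

/-- The length of the image of a set under an injective `C¹` curve is at least the integral of the
speed. -/
theorem lintegral_enorm_deriv_le_hausdorffMeasure_image {E : Type*} [NormedAddCommGroup E]
    [NormedSpace ℝ E] [MeasurableSpace E] [BorelSpace E] {γ : ℝ → E} (hγ : ContDiff ℝ 1 γ)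
    {A : Set ℝ} (hA : MeasurableSet A) (hsub : A ⊆ Icc 0 1) (hinj : InjOn γ A) :
    ∫⁻ t in A, ‖deriv γ t‖ₑ ≤ μH[1] (γ '' A) := by
  have hd : Differentiable ℝ γ := hγ.differentiable one_ne_zero
  have hdc : Continuous (deriv γ) := hγ.continuous_deriv le_rfl
  have hvol : volume A ≤ 1 := (measure_mono hsub).trans (by simp)
  have key : ∀ ε : NNReal, 0 < ε →
      ∫⁻ t in A, ‖deriv γ t‖ₑ ≤ μH[1] (γ '' A) + 2 * ε := by
    intro ε hε
    -- On cells of length δ the velocity varies by at most ε. The final error is 2ε: one ε for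
    -- freezing the velocity in the measure estimate, one for freezing the speed in the integral.
    obtain ⟨δ, hδ, hunif⟩ := Metric.uniformContinuousOn_iff.1
      (isCompact_Icc.uniformContinuousOn_of_continuous (hdc.continuousOn (s := Icc (0:ℝ) 1)))
      ε (NNReal.coe_pos.2 hε)
    set t : ℤ → Set ℝ := fun n => Ico (n • δ) ((n + 1) • δ) with htdef
    have hdisj : Pairwise (Function.onFun Disjoint t) := pairwise_disjoint_Ico_zsmul δ
    have ht : ∀ n, MeasurableSet (t n) := fun n => measurableSet_Ico
    have hmeas : ∀ n, MeasurableSet (A ∩ t n) := fun n => hA.inter (ht n)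
    have hAeq : A = ⋃ n, A ∩ t n := by
      rw [← inter_iUnion, iUnion_Ico_zsmul hδ, inter_univ]
    have hdisj' : Pairwise (Function.onFun Disjoint fun n => A ∩ t n) := fun i j hij =>
      (hdisj hij).mono inter_subset_right inter_subset_right
    have hpiece : ∀ n, ∫⁻ x in A ∩ t n, ‖deriv γ x‖ₑ
        ≤ μH[1] (γ '' (A ∩ t n)) + 2 * ε * volume (A ∩ t n) := by
      intro n
      rcases (A ∩ t n).eq_empty_or_nonempty with h | ⟨x₀, hx₀⟩
      · simp [h]
      have hosc : ∀ x ∈ Icc 0 1 ∩ t n, ‖deriv γ x - deriv γ x₀‖ ≤ ε := by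
        rintro x ⟨hx1, hx2, hx3⟩
        rw [← dist_eq_norm]
        refine (hunif x hx1 x₀ (hsub hx₀.1) ?_).le
        have h2 := hx₀.2.1
        have h3 := hx₀.2.2
        rw [add_smul, one_smul] at hx3 h3
        rw [Real.dist_eq, abs_lt]
        constructor <;> linarith
      have h1 := mul_volume_le_hausdorffMeasure_image hd (J := Icc 0 1 ∩ t n) (A := A ∩ t n)
        ((convex_Icc 0 1).inter (convex_Ico _ _)) (inter_subset_inter_left _ hsub)
        (deriv γ x₀) ε hosc
      calc ∫⁻ x in A ∩ t n, ‖deriv γ x‖ₑ ≤ ∫⁻ x in A ∩ t n, (‖deriv γ x₀‖ₑ + ε) := by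
            refine setLIntegral_mono measurable_const fun x hx => ?_
            have := hosc x ⟨hsub hx.1, hx.2⟩
            calc ‖deriv γ x‖ₑ = ‖deriv γ x₀ + (deriv γ x - deriv γ x₀)‖ₑ := by
                  congr 1; abel
              _ ≤ ‖deriv γ x₀‖ₑ + ‖deriv γ x - deriv γ x₀‖ₑ := enorm_add_le _ _
              _ ≤ _ := by
                gcongr
                rw [← ofReal_norm]
                exact (ENNReal.ofReal_le_ofReal this).trans (by simp)
        _ = ‖deriv γ x₀‖ₑ * volume (A ∩ t n) + ε * volume (A ∩ t n) := by
            rw [setLIntegral_const, add_mul]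
        _ ≤ _ := by
            rw [two_mul, add_mul, ← add_assoc]
            gcongr
    have himg : ∀ n, MeasurableSet (γ '' (A ∩ t n)) := fun n =>
      (hmeas n).image_of_continuousOn_injOn hγ.continuous.continuousOn
        (hinj.mono inter_subset_left)
    calc ∫⁻ t in A, ‖deriv γ t‖ₑ = ∑' n, ∫⁻ x in A ∩ t n, ‖deriv γ x‖ₑ := by
          conv_lhs => rw [hAeq]
          exact lintegral_iUnion hmeas hdisj' _
      _ ≤ ∑' n, (μH[1] (γ '' (A ∩ t n)) + 2 * ε * volume (A ∩ t n)) :=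
          ENNReal.tsum_le_tsum hpiece
      _ = μH[1] (γ '' A) + 2 * ε * volume A := by
          rw [ENNReal.tsum_add, ENNReal.tsum_mul_left]
          conv_rhs => rw [hAeq, image_iUnion]
          rw [measure_iUnion hdisj' hmeas, measure_iUnion _ himg]
          intro i j hij
          refine Set.disjoint_left.2 ?_
          rintro _ ⟨x, hx, rfl⟩ ⟨y, hy, hxy⟩
          exact (hdisj' hij).le_bot ⟨hx, by rw [← hinj hy.1 hx.1 hxy]; exact hy⟩
      _ ≤ μH[1] (γ '' A) + 2 * ε * 1 := by gcongr
      _ = _ := by rw [mul_one]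
  refine ENNReal.le_of_forall_pos_le_add fun ε hε _ => ?_
  refine (key (ε / 2) (by positivity)).trans ?_
  gcongr
  rw [ENNReal.coe_div two_ne_zero, ENNReal.coe_ofNat, ENNReal.mul_div_cancel two_ne_zero (by simp)]

/-- The one-dimensional change of variables inequality. -/
theorem volume_image_le_lintegral_enorm_deriv {f f' : ℝ → ℝ} {A : Set ℝ} (hA : MeasurableSet A)
    (hf : ∀ x ∈ A, HasDerivAt f (f' x) x) :
    volume (f '' A) ≤ ∫⁻ x in A, ‖f' x‖ₑ := by
  have := addHaar_image_le_lintegral_abs_det_fderiv volume hA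
    (fun x hx => (hf x hx).hasFDerivAt.hasFDerivWithinAt (s := A))
  simpa [← Real.enorm_eq_ofReal_abs] using this

/-- If every point of `Y` is attained at least twice by a finite family of functions, then the total
variation of the family is at least twice the measure of `Y`. -/
theorem two_mul_volume_le_sum_lintegral {ι : Type*} [Fintype ι] {f f' : ι → ℝ → ℝ} {A : ι → Set ℝ}
    (hA : ∀ i, MeasurableSet (A i)) (hf : ∀ i, ∀ x ∈ A i, HasDerivAt (f i) (f' i x) x) {Y : Set ℝ}
    (hY : ∀ y ∈ Y, ∃ i s j t, s ∈ A i ∧ t ∈ A j ∧ f i s = y ∧ f j t = y ∧ (i = j → s ≠ t)) :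
    2 * volume Y ≤ ∑ i, ∫⁻ x in A i, ‖f' i x‖ₑ := by
  set d : ℕ → ℝ := fun n => ((n : ℝ) + 1)⁻¹ with hd
  have hd0 : ∀ n, 0 < d n := fun n => by positivity
  set T : ℕ → ℤ → Set ℝ := fun n k => Ico (k • d n) ((k + 1) • d n) with hT
  set S : ℕ → ι → ℤ → Set ℝ := fun n i k => toMeasurable volume (f i '' (A i ∩ T n k)) with hS
  -- A discrete Banach indicatrix: it counts the cells of length `d n` whose image, replaced by a
  -- measurable hull, contains y. Each cell contributes at most its variation to the integral. Two
  -- distinct parameters over y eventually fall into different cells, so the count is eventually at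
  -- least 2 on Y, and Fatou's lemma concludes.
  set h : ℕ → ℝ → ℝ≥0∞ := fun n y => ∑ i, ∑' k, (S n i k).indicator 1 y with hh
  have hSm : ∀ n i k, MeasurableSet (S n i k) := fun n i k => measurableSet_toMeasurable _ _
  have hmeas : ∀ n, Measurable (h n) := fun n =>
    Finset.measurable_sum _ fun i _ => Measurable.tsum fun k =>
      (measurable_one.indicator (hSm n i k))
  have hint : ∀ n, ∫⁻ y, h n y ≤ ∑ i, ∫⁻ x in A i, ‖f' i x‖ₑ := by
    intro n
    rw [lintegral_finsetSum _ fun i _ => Measurable.tsum fun k =>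
      (measurable_one.indicator (hSm n i k))]
    refine Finset.sum_le_sum fun i _ => ?_
    rw [lintegral_tsum fun k => (measurable_one.indicator (hSm n i k)).aemeasurable]
    have hAeq : A i = ⋃ k, A i ∩ T n k := by
      rw [← inter_iUnion, iUnion_Ico_zsmul (hd0 n), inter_univ]
    conv_rhs => rw [hAeq]
    rw [lintegral_iUnion (fun k => (hA i).inter measurableSet_Ico) (fun k l hkl =>
      (pairwise_disjoint_Ico_zsmul (d n) hkl).mono inter_subset_right inter_subset_right)]
    refine ENNReal.tsum_le_tsum fun k => ?_
    rw [lintegral_indicator_one (hSm n i k), hS, measure_toMeasurable]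
    exact volume_image_le_lintegral_enorm_deriv ((hA i).inter measurableSet_Ico)
      fun x hx => hf i x hx.1
  have hmem : ∀ n s, ∃ k, s ∈ T n k := fun n s => by
    have : s ∈ ⋃ k, T n k := by rw [iUnion_Ico_zsmul (hd0 n)]; trivial
    simpa using this
  have hone : ∀ n i k s, s ∈ A i → s ∈ T n k →
      (S n i k).indicator (1 : ℝ → ℝ≥0∞) (f i s) = 1 := by
    intro n i k s hs hk
    have : f i s ∈ S n i k := subset_toMeasurable _ _ (mem_image_of_mem _ ⟨hs, hk⟩)
    rw [indicator_of_mem this]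
    rfl
  have hlim : ∀ y ∈ Y, 2 ≤ liminf (fun n => h n y) atTop := by
    intro y hy
    obtain ⟨i, s, j, t, hs, ht, rfl, hjt, hne⟩ := hY y hy
    refine le_liminf_of_le (by isBoundedDefault) ?_
    by_cases hij : i = j
    · subst hij
      have hst : 0 < |s - t| := abs_pos.2 (sub_ne_zero.2 (hne rfl))
      have hev : ∀ᶠ n in atTop, d n < |s - t| :=
        (tendsto_order.1 (tendsto_inv_atTop_zero.comp
          (tendsto_atTop_add_const_right _ 1 tendsto_natCast_atTop_atTop))).2 _ hst
      filter_upwards [hev] with n hn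
      obtain ⟨k, hk⟩ := hmem n s
      obtain ⟨l, hl⟩ := hmem n t
      have hkl : k ≠ l := by
        rintro rfl
        have h1 := hk.1; have h2 := hk.2; have h3 := hl.1; have h4 := hl.2
        rw [add_smul, one_smul] at h2 h4
        have : |s - t| < d n := by rw [abs_lt]; constructor <;> linarith
        linarith
      calc (2 : ℝ≥0∞) = ∑ m ∈ {k, l}, (S n i m).indicator 1 (f i s) := by
            rw [Finset.sum_pair hkl, hone n i k s hs hk]
            conv_rhs => rw [← hjt]
            rw [hone n i l t ht hl, one_add_one_eq_two]
        _ ≤ ∑' m, (S n i m).indicator 1 (f i s) := ENNReal.sum_le_tsum _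
        _ ≤ h n (f i s) := Finset.single_le_sum
            (f := fun i' => ∑' m, (S n i' m).indicator (1 : ℝ → ℝ≥0∞) (f i s))
            (fun _ _ => zero_le) (Finset.mem_univ i)
    · refine Eventually.of_forall fun n => ?_
      obtain ⟨k, hk⟩ := hmem n s
      obtain ⟨l, hl⟩ := hmem n t
      classical
      calc (2 : ℝ≥0∞) = (S n i k).indicator 1 (f i s) + (S n j l).indicator 1 (f i s) := by
            rw [hone n i k s hs hk]
            conv_rhs => rw [← hjt]
            rw [hone n j l t ht hl, one_add_one_eq_two]
        _ ≤ (∑' m, (S n i m).indicator 1 (f i s)) + ∑' m, (S n j m).indicator 1 (f i s) :=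
            add_le_add (ENNReal.le_tsum k) (ENNReal.le_tsum l)
        _ = ∑ i' ∈ {i, j}, ∑' m, (S n i' m).indicator 1 (f i s) := by rw [Finset.sum_pair hij]
        _ ≤ h n (f i s) := Finset.sum_le_sum_of_subset (Finset.subset_univ _)
  calc 2 * volume Y ≤ 2 * volume {y | 2 ≤ liminf (fun n => h n y) atTop} := by
        gcongr; exact hlim
    _ ≤ ∫⁻ y, liminf (fun n => h n y) atTop :=
        mul_meas_ge_le_lintegral (Measurable.liminf hmeas) 2
    _ ≤ liminf (fun n => ∫⁻ y, h n y) atTop := lintegral_liminf_le hmeas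
    _ ≤ liminf (fun _ : ℕ => ∑ i, ∫⁻ x in A i, ‖f' i x‖ₑ) atTop :=
        liminf_le_liminf (Eventually.of_forall hint)
    _ = _ := liminf_const _

/-! ### Radii that end on the frontier of a subset of the disk -/

/-- An open set with a segment that avoids its frontier contains both or none of its end points. -/
theorem IsOpen.mem_of_segment_disjoint_frontier {E : Type*} [AddCommGroup E] [Module ℝ E]
    [TopologicalSpace E] [IsTopologicalAddGroup E] [ContinuousSMul ℝ E] {Ω : Set E} (hΩ : IsOpen Ω)
    {a b : E} (ha : a ∈ Ω) (h : ∀ z ∈ segment ℝ a b, z ∉ frontier Ω) : b ∈ Ω :=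
  (convex_segment a b).isPreconnected.subset_of_disjoint_frontier hΩ (disjoint_left.2 h)
    ⟨a, left_mem_segment ℝ a b, ha⟩ (right_mem_segment ℝ a b)

/-- In coordinates, the frontier of an open subset of the disk is near a boundary point `1` the graph
of a continuous function; then the radius ending at `1` finally lies in the set. -/
theorem eventually_ofReal_mem_of_frontier_graph {Ω : Set ℂ} (hΩ : IsOpen Ω)
    (hsub : Ω ⊆ Metric.ball 0 1) (h1 : (1 : ℂ) ∈ frontier Ω) {G : ℝ → ℝ} (hG : ContinuousAt G 0)
    (hG0 : G 0 = 1) (hfr : ∀ᶠ z : ℂ in 𝓝 1, z ∈ frontier Ω ↔ z.re = G z.im) :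
    ∀ᶠ s : ℝ in 𝓝[<] 1, (s : ℂ) ∈ Ω := by
  obtain ⟨δ, hδ, hball⟩ := Metric.eventually_nhds_iff.1 hfr
  set κ := min (δ / 2) 1 with hκ
  have hκ0 : 0 < κ := by positivity
  obtain ⟨h₀, hh₀, hGh⟩ := Metric.continuousAt_iff.1 hG (κ / 2) (by positivity)
  set h := min (δ / 2) h₀ with hh
  have hh0 : 0 < h := by positivity
  have hbox : ∀ z : ℂ, |z.im| < h → |z.re - 1| < κ → (z ∈ frontier Ω ↔ z.re = G z.im) := by
    intro z hz1 hz2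
    apply hball
    rw [dist_eq_norm]
    refine (Complex.norm_le_abs_re_add_abs_im _).trans_lt ?_
    have h3 : κ ≤ δ / 2 := min_le_left _ _
    have h4 : h ≤ δ / 2 := min_le_left _ _
    simp only [Complex.sub_re, Complex.one_re, Complex.sub_im, Complex.one_im, sub_zero]
    linarith
  have hGx : ∀ x : ℝ, |x| < h → |G x - 1| < κ / 2 := by
    intro x hx
    have := hGh (x := x) (by rw [Real.dist_eq, sub_zero]; exact hx.trans_le (min_le_right _ _))
    rwa [hG0, Real.dist_eq] at this
  -- segments below the graph
  have hseg : ∀ a b : ℂ, a ∈ Ω → |a.im| < h → |b.im| < h → |a.re - 1| < κ → |b.re - 1| < κ →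
      (∀ z ∈ segment ℝ a b, z.re ≠ G z.im) → b ∈ Ω := by
    intro a b ha ha1 hb1 ha2 hb2 hz
    refine hΩ.mem_of_segment_disjoint_frontier ha fun z hzs hzf => hz z hzs ((hbox z ?_ ?_).1 hzf)
    · obtain ⟨s, t, hs, ht, hst, rfl⟩ := hzs
      have := convex_Ioo (-h) h (abs_lt.1 ha1) (abs_lt.1 hb1) hs ht hst
      rw [abs_lt]
      simpa using this
    · obtain ⟨s, t, hs, ht, hst, rfl⟩ := hzs
      rw [abs_sub_lt_iff] at ha2 hb2 ⊢
      have := convex_Ioo (1 - κ) (1 + κ) (x := a.re) (y := b.re)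
        ⟨by linarith, by linarith⟩ ⟨by linarith, by linarith⟩ hs ht hst
      simp only [smul_eq_mul, mem_Ioo] at this
      simp only [Complex.add_re, Complex.real_smul, Complex.mul_re, Complex.ofReal_re,
        Complex.ofReal_im, zero_mul, sub_zero]
      constructor <;> linarith
  -- a point of `Ω` in the box
  obtain ⟨p, hpΩ, hp1, hp2⟩ : ∃ p ∈ Ω, |p.im| < h ∧ |p.re - 1| < κ := by
    have : {z : ℂ | |z.im| < h ∧ |z.re - 1| < κ} ∈ 𝓝 (1 : ℂ) := by
      refine IsOpen.mem_nhds ?_ (by simp [hh0, hκ0])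
      exact (isOpen_lt (f := fun z : ℂ => |z.im|) (by fun_prop) continuous_const).inter
        (isOpen_lt (f := fun z : ℂ => |z.re - 1|) (by fun_prop) continuous_const)
    obtain ⟨p, hp, hpΩ⟩ := mem_closure_iff_nhds.1 (frontier_subset_closure h1) _ this
    exact ⟨p, hpΩ, hp.1, hp.2⟩
  have hpfr : p.re ≠ G p.im := fun h => by
    have := (hbox p hp1 hp2).2 h
    rw [hΩ.frontier_eq] at this
    exact this.2 hpΩ
  have hvert : ∀ (a b : ℂ), a.im = b.im → ∀ z ∈ segment ℝ a b, z.im = a.im ∧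
      min a.re b.re ≤ z.re ∧ z.re ≤ max a.re b.re := by
    rintro a b hab z ⟨s, t, hs, ht, hst, rfl⟩
    simp only [Complex.add_im, Complex.add_re, Complex.real_smul, Complex.mul_im, Complex.mul_re,
      Complex.ofReal_re, Complex.ofReal_im, zero_mul, add_zero, sub_zero]
    exact ⟨by rw [← hab, ← add_mul, hst, one_mul],
      convex_Icc (min a.re b.re) (max a.re b.re) ⟨min_le_left _ _, le_max_left _ _⟩
        ⟨min_le_right _ _, le_max_right _ _⟩ hs ht hst⟩
  -- A point of Ω beyond the graph could be moved in the direction of increasing real part without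
  -- meeting the frontier until its real part is at least 1, hence out of the disk. So Ω lies on the
  -- inner side of the graph.
  have hplt : p.re < G p.im := by
    refine lt_of_le_of_ne (not_lt.1 fun hgt => ?_) hpfr
    set b : ℂ := ⟨max p.re 1, p.im⟩ with hb
    have hpb : p.re ≤ b.re := le_max_left _ _
    have hb2 : |b.re - 1| < κ := by
      rw [abs_lt] at hp2 ⊢
      simp only [hb]
      constructor
      · linarith [le_max_right p.re 1]
      · rcases max_cases p.re 1 with ⟨h, -⟩ | ⟨h, -⟩ <;> rw [h] <;> linarith
    have hbΩ : b ∈ Ω := by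
      refine hseg p b hpΩ hp1 hp1 hp2 hb2 fun z hz => ?_
      obtain ⟨h2, h3, -⟩ := hvert p b rfl z hz
      rw [h2]
      rw [min_eq_left hpb] at h3
      linarith
    have h5 := hsub hbΩ
    rw [mem_ball_zero_iff] at h5
    have h6 := Complex.re_le_norm b
    have h7 : 1 ≤ b.re := le_max_right _ _
    linarith
  -- The graph stays within κ/2 of real part 1 and the box reaches to κ, so the line at distance
  -- 3κ/4 runs inside the box and on the inner side of the graph. The path from p follows it to the
  -- real axis and then the radius outwards.
  set y₁ : ℝ := 1 - 3 / 4 * κ with hy₁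
  have hy₁κ : |y₁ - 1| < κ := by rw [abs_lt]; constructor <;> simp only [hy₁] <;> linarith
  have hyG : ∀ x, |x| < h → y₁ < G x := by
    intro x hx
    have := (abs_lt.1 (hGx x hx)).1
    simp only [hy₁]; linarith
  have hq : (⟨y₁, p.im⟩ : ℂ) ∈ Ω := by
    refine hseg p _ hpΩ hp1 hp1 hp2 hy₁κ fun z hz => ?_
    obtain ⟨h2, -, h3⟩ := hvert p ⟨y₁, p.im⟩ rfl z hz
    rw [h2]
    exact (h3.trans_lt (max_lt hplt (hyG _ hp1))).ne
  have hq0 : (⟨y₁, 0⟩ : ℂ) ∈ Ω := by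
    refine hseg _ _ hq hp1 (by simpa using hh0) hy₁κ hy₁κ ?_
    rintro z ⟨s, t, hs, ht, hst, rfl⟩
    simp only [Complex.add_im, Complex.add_re, Complex.real_smul, Complex.mul_im, Complex.mul_re,
      Complex.ofReal_re, Complex.ofReal_im, zero_mul, add_zero, sub_zero]
    rw [← add_mul, hst, one_mul]
    refine (hyG _ ?_).ne
    rw [mul_zero, add_zero, abs_mul, abs_of_nonneg hs]
    nlinarith [abs_nonneg p.im]
  filter_upwards [Ioo_mem_nhdsLT (show 1 - κ < 1 by linarith)] with s hs
  have hs' : (s : ℂ) = ⟨s, 0⟩ := rfl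
  rw [hs']
  refine hseg _ _ hq0 (by simpa using hh0) (by simpa using hh0) hy₁κ ?_ fun z hz => ?_
  · rw [abs_lt]; constructor <;> simp only <;> linarith [hs.1, hs.2]
  · obtain ⟨h2, -, h3⟩ := hvert ⟨y₁, 0⟩ ⟨s, 0⟩ rfl z hz
    rw [h2, hG0]
    exact (h3.trans_lt (max_lt (by simp only [hy₁]; linarith) hs.2)).ne

/-- A radius that ends at an interior point of a boundary arc of an open subset of the disk finally
lies in the set. -/
theorem eventually_ofReal_mem_of_arc {Ω : Set ℂ} (hΩ : IsOpen Ω)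
    (hsub : Ω ⊆ Metric.ball 0 1) {γ : ℝ → ℂ} (hγ : ContDiff ℝ 1 γ) {t₀ : ℝ}
    (ht₀ : t₀ ∈ Ioo (0 : ℝ) 1) (hγ₀ : γ t₀ = 1) (hγ' : deriv γ t₀ ≠ 0) (hinj : InjOn γ (Icc 0 1))
    (hfr : ∀ᶠ z in 𝓝 (1 : ℂ), z ∈ frontier Ω ↔ z ∈ γ '' Icc 0 1) :
    ∀ᶠ s : ℝ in 𝓝[<] 1, (s : ℂ) ∈ Ω := by
  have hd : HasStrictDerivAt γ (deriv γ t₀) t₀ :=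
    hγ.contDiffAt.hasStrictDerivAt one_ne_zero
  have hcont : ContinuousAt γ t₀ := hγ.continuous.continuousAt
  have hx : HasStrictDerivAt (fun t => (γ t).im) (deriv γ t₀).im t₀ := by
    exact Complex.imCLM.hasStrictFDerivAt.comp_hasStrictDerivAt t₀ hd
  have hy : HasDerivAt (fun t => (γ t).re) (deriv γ t₀).re t₀ := by
    exact Complex.reCLM.hasFDerivAt.comp_hasDerivAt t₀ hd.hasDerivAt
  have h1 : (1 : ℂ) ∈ frontier Ω :=
    hfr.self_of_nhds.2 ⟨t₀, Ioo_subset_Icc_self ht₀, hγ₀⟩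
  have hclosed : ∀ z ∈ frontier Ω, ‖z‖ ≤ 1 := fun z hz => by
    have := closure_mono hsub (frontier_subset_closure hz)
    simpa using Metric.closure_ball_subset_closedBall this
  -- The frontier lies in the closed disk, so the real part along the arc is maximal at t₀. Hence
  -- the arc is tangent to the circle there and the imaginary part is a local parameter.
  have hy0 : (deriv γ t₀).re = 0 := by
    have hmax : IsLocalMax (fun t => (γ t).re) t₀ := by
      have h2 : ∀ᶠ t in 𝓝 t₀, γ t ∈ γ '' Icc 0 1 → γ t ∈ frontier Ω := by
        have := hcont.eventually (by rw [hγ₀]; exact hfr)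
        filter_upwards [this] with t ht using ht.2
      filter_upwards [h2, Icc_mem_nhds ht₀.1 ht₀.2] with t ht htI
      rw [hγ₀, Complex.one_re]
      exact (Complex.re_le_norm _).trans (hclosed _ (ht ⟨t, htI, rfl⟩))
    exact hmax.hasDerivAt_eq_zero hy
  have hx0 : (deriv γ t₀).im ≠ 0 := fun h => hγ' (Complex.ext hy0 h)
  set g := hx.localInverse _ _ _ hx0 with hg
  have hgl : ∀ᶠ t in 𝓝 t₀, g (γ t).im = t :=
    (hx.hasStrictFDerivAt_equiv hx0).eventually_left_inverse
  have hgr : ∀ᶠ x in 𝓝 (0 : ℝ), (γ (g x)).im = x := by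
    have := (hx.hasStrictFDerivAt_equiv hx0).eventually_right_inverse
    simpa [hγ₀] using this
  have hg0 : g 0 = t₀ := by simpa [hγ₀] using hgl.self_of_nhds
  have hgc : ContinuousAt g 0 := by
    have := (hx.to_localInverse hx0).hasDerivAt.continuousAt
    simpa [hγ₀] using this
  have hgc' : Tendsto g (𝓝 0) (𝓝 t₀) := by rw [← hg0]; exact hgc
  have hGc : ContinuousAt (fun x => (γ (g x)).re) 0 :=
    Complex.continuous_re.continuousAt.comp (hγ.continuous.continuousAt.comp hgc)
  refine eventually_ofReal_mem_of_frontier_graph hΩ hsub h1 hGc (by simp [hg0, hγ₀]) ?_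
  -- near `1` the arc is the image of a small parameter interval
  obtain ⟨U, hU, hUo, hUt⟩ := eventually_nhds_iff.1 hgl
  have hK : IsCompact (γ '' (Icc 0 1 \ U)) :=
    (isCompact_Icc.diff hUo).image hγ.continuous
  have hfar : ∀ᶠ z in 𝓝 (1 : ℂ), z ∉ γ '' (Icc 0 1 \ U) := by
    refine hK.isClosed.isOpen_compl.mem_nhds ?_
    rintro ⟨t, ht, hte⟩
    rw [← hγ₀] at hte
    rw [hinj ht.1 (Ioo_subset_Icc_self ht₀) hte] at ht
    exact ht.2 hUt
  have him : Tendsto Complex.im (𝓝 (1 : ℂ)) (𝓝 0) := by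
    have := Complex.continuous_im.tendsto (1 : ℂ)
    rwa [Complex.one_im] at this
  filter_upwards [hfr, hfar, him.eventually hgr,
    (hgc'.comp him).eventually (Icc_mem_nhds ht₀.1 ht₀.2)] with z hz1 hz2 hz3 hz4
  rw [hz1]
  constructor
  · rintro ⟨t, ht, rfl⟩
    have htU : t ∈ U := by
      by_contra h
      exact hz2 ⟨t, ⟨ht, h⟩, rfl⟩
    rw [hU t htU]
  · intro hre
    exact ⟨g z.im, hz4, Complex.ext hre.symm hz3⟩

/-- The frontier of a set in the complex plane is parametrized by finitely many embedded arcs. -/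
structure IsArcFrontier {m : ℕ} (Ω : Set ℂ) (γ : Fin m → ℝ → ℂ) : Prop where
  contDiff : ∀ i, ContDiff ℝ 1 (γ i)
  deriv_ne_zero : ∀ i, ∀ t ∈ Icc (0 : ℝ) 1, deriv (γ i) t ≠ 0
  injOn : ∀ i, InjOn (γ i) (Icc 0 1)
  disjoint : ∀ i j, i ≠ j → Disjoint (γ i '' Ioo 0 1) (γ j '' Icc 0 1)
  frontier_eq : frontier Ω = ⋃ i, γ i '' Icc 0 1

/-- The finite set of end points of the arcs. -/
def arcEndpoints {m : ℕ} (γ : Fin m → ℝ → ℂ) : Set ℂ := ⋃ i, {γ i 0, γ i 1}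

theorem arcEndpoints_finite {m : ℕ} (γ : Fin m → ℝ → ℂ) : (arcEndpoints γ).Finite :=
  finite_iUnion fun _ => (finite_singleton _).insert _

theorem mem_image_Ioo_of_notMem_arcEndpoints {m : ℕ} {γ : Fin m → ℝ → ℂ} {i : Fin m} {t : ℝ}
    (ht : t ∈ Icc (0 : ℝ) 1) (h : γ i t ∉ arcEndpoints γ) : t ∈ Ioo (0 : ℝ) 1 := by
  refine ⟨lt_of_le_of_ne ht.1 ?_, lt_of_le_of_ne ht.2 ?_⟩
  · rintro rfl
    exact h (mem_iUnion.2 ⟨i, Or.inl rfl⟩)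
  · rintro rfl
    exact h (mem_iUnion.2 ⟨i, Or.inr rfl⟩)

/-- At all but finitely many frontier points `q` on the unit circle of a piecewise smoothly bounded
open subset of the disk, the radius ending at `q` finally lies in the set. -/
theorem IsArcFrontier.eventually_mul_mem {m : ℕ} {Ω : Set ℂ} {γ : Fin m → ℝ → ℂ}
    (h : IsArcFrontier Ω γ) (hΩ : IsOpen Ω) (hsub : Ω ⊆ Metric.ball 0 1) {q : ℂ} (hq : ‖q‖ = 1)
    (hqf : q ∈ frontier Ω) (hqe : q ∉ arcEndpoints γ) :
    ∀ᶠ s : ℝ in 𝓝[<] 1, q * (s : ℂ) ∈ Ω := by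
  have hq0 : q ≠ 0 := by rintro rfl; simp at hq
  obtain ⟨i, t₀, ht₀, rfl⟩ : ∃ i, ∃ t ∈ Icc (0 : ℝ) 1, γ i t = q := by
    rw [h.frontier_eq] at hqf
    simpa using hqf
  have htI := mem_image_Ioo_of_notMem_arcEndpoints ht₀ hqe
  set q := γ i t₀ with hqdef
  -- A rotation moves q to 1. Near q only the arc through q matters, since the other arcs are
  -- compact and miss its interior points.
  set e : ℂ ≃ₜ ℂ := Homeomorph.mulLeft₀ q hq0 with he
  have he1 : e 1 = q := by simp [he]
  have hec : Tendsto e (𝓝 1) (𝓝 q) := by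
    have := e.continuous.tendsto 1
    rwa [he1] at this
  have hfr : ∀ᶠ z in 𝓝 q, z ∈ frontier Ω ↔ z ∈ γ i '' Icc 0 1 := by
    have h1 : ∀ᶠ z in 𝓝 q, ∀ j, j ≠ i → z ∉ γ j '' Icc 0 1 := by
      refine eventually_all.2 fun j => ?_
      by_cases hj : j = i
      · simp [hj]
      have : IsClosed (γ j '' Icc 0 1) :=
        (isCompact_Icc.image (h.contDiff j).continuous).isClosed
      filter_upwards [this.isOpen_compl.mem_nhds (disjoint_left.1 (h.disjoint i j (Ne.symm hj))
        (mem_image_of_mem _ htI))] with z hz _ using hz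
    filter_upwards [h1] with z hz
    rw [h.frontier_eq, mem_iUnion]
    constructor
    · rintro ⟨j, hj⟩
      by_cases hji : j = i
      · rwa [hji] at hj
      · exact absurd hj (hz j hji)
    · exact fun hz => ⟨i, hz⟩
  have key := eventually_ofReal_mem_of_arc (Ω := e ⁻¹' Ω) (hΩ.preimage e.continuous) ?_
    (γ := fun t => q⁻¹ * γ i t) (contDiff_const.mul (h.contDiff i)) htI
    (inv_mul_cancel₀ hq0) ?_ ?_ ?_
  · exact key
  · intro z hz
    have := hsub hz
    simpa [he, hq] using this
  · rw [deriv_const_mul_field]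
    exact mul_ne_zero (inv_ne_zero hq0) (h.deriv_ne_zero i t₀ ht₀)
  · intro s hs t ht hst
    exact h.injOn i hs ht (mul_left_cancel₀ (inv_ne_zero hq0) hst)
  · rw [← e.preimage_frontier]
    filter_upwards [hec.eventually hfr] with z hz
    rw [mem_preimage, hz]
    constructor
    · rintro ⟨t, ht, hte⟩
      refine ⟨t, ht, ?_⟩
      simp only
      rw [hte]
      simp [he, hq0]
    · rintro ⟨t, ht, rfl⟩
      refine ⟨t, ht, ?_⟩
      simp [he, hq0]

/-! ### Circles, boundary angles and crossed radii -/

/-- The point `r e^{iθ}`. -/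
noncomputable def polarPoint (r θ : ℝ) : ℂ := r * Complex.exp (θ * Complex.I)

theorem norm_polarPoint (r θ : ℝ) : ‖polarPoint r θ‖ = |r| := by
  simp [polarPoint, Complex.norm_exp_ofReal_mul_I]

theorem polarPoint_norm_arg (z : ℂ) : polarPoint ‖z‖ z.arg = z := Complex.norm_mul_exp_arg_mul_I z

theorem arg_polarPoint {r θ : ℝ} (hr : 0 < r) (hθ : θ ∈ Ioc (-Real.pi) Real.pi) :
    (polarPoint r θ).arg = θ := by
  rw [polarPoint, Complex.exp_mul_I, Complex.arg_mul_cos_add_sin_mul_I hr hθ]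

theorem continuous_polarPoint_right (r : ℝ) : Continuous (polarPoint r) := by
  unfold polarPoint; fun_prop

theorem continuous_polarPoint_left (θ : ℝ) : Continuous fun r => polarPoint r θ := by
  unfold polarPoint; fun_prop

theorem polarPoint_add_two_pi (r θ : ℝ) : polarPoint r (θ + 2 * Real.pi) = polarPoint r θ := by
  unfold polarPoint
  push_cast
  rw [add_mul, Complex.exp_periodic (θ * Complex.I)]

/-- A circle that meets the frontier of an open set at most once lies, up to one point, in the set
or in its complement. -/
theorem circle_subset_or_disjoint_of_subsingleton {Ω : Set ℂ} (hΩ : IsOpen Ω) {r : ℝ} (hr : 0 < r)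
    (hs : ∀ z ∈ frontier Ω, ∀ w ∈ frontier Ω, ‖z‖ = r → ‖w‖ = r → z = w) :
    ∃ φ, (∀ θ ∈ Ioc (-Real.pi) Real.pi, θ ≠ φ → polarPoint r θ ∈ Ω) ∨
      ∀ θ ∈ Ioc (-Real.pi) Real.pi, θ ≠ φ → polarPoint r θ ∉ Ω := by
  obtain ⟨φ, hφ, hmiss⟩ : ∃ φ ∈ Ioc (-Real.pi) Real.pi, ∀ θ ∈ Ioc (-Real.pi) Real.pi,
      θ ≠ φ → polarPoint r θ ∉ frontier Ω := by
    by_cases h : ∃ z ∈ frontier Ω, ‖z‖ = r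
    · obtain ⟨z, hz, hzr⟩ := h
      refine ⟨z.arg, Complex.arg_mem_Ioc z, fun θ hθ hne hf => hne ?_⟩
      rw [hs z hz _ hf hzr (by rw [norm_polarPoint, abs_of_pos hr]), arg_polarPoint hr hθ]
    · push Not at h
      exact ⟨Real.pi, ⟨by linarith [Real.pi_pos], le_rfl⟩, fun θ _ _ hf =>
        h _ hf (by rw [norm_polarPoint, abs_of_pos hr])⟩
  have hrep : ∀ θ ∈ Ioc (-Real.pi) Real.pi, θ ≠ φ →
      polarPoint r θ ∈ polarPoint r '' Ioo φ (φ + 2 * Real.pi) := by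
    intro θ hθ hne
    rcases lt_or_gt_of_ne hne with h | h
    · exact ⟨θ + 2 * Real.pi, ⟨by linarith [hθ.1, hφ.2], by linarith⟩, polarPoint_add_two_pi r θ⟩
    · exact ⟨θ, ⟨h, by linarith [hθ.2, hφ.1]⟩, rfl⟩
  have hmiss' : Disjoint (polarPoint r '' Ioo φ (φ + 2 * Real.pi)) (frontier Ω) := by
    rw [disjoint_left]
    rintro _ ⟨θ, hθ, rfl⟩ hf
    by_cases h : θ ≤ Real.pi
    · exact hmiss θ ⟨hφ.1.trans hθ.1, h⟩ hθ.1.ne' hf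
    · push Not at h
      refine hmiss (θ - 2 * Real.pi) ⟨by linarith, by linarith [hθ.2, hφ.2]⟩
        (by linarith [hθ.2]) ?_
      rwa [← polarPoint_add_two_pi, sub_add_cancel]
  have hpre : IsPreconnected (polarPoint r '' Ioo φ (φ + 2 * Real.pi)) :=
    isPreconnected_Ioo.image _ (continuous_polarPoint_right r).continuousOn
  refine ⟨φ, ?_⟩
  by_cases h : ((polarPoint r '' Ioo φ (φ + 2 * Real.pi)) ∩ Ω).Nonempty
  · left
    exact fun θ hθ hne => hpre.subset_of_disjoint_frontier hΩ hmiss' h (hrep θ hθ hne)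
  · right
    exact fun θ hθ hne hmem => h ⟨_, hrep θ hθ hne, hmem⟩

/-- The directions in which the open set reaches the unit circle. -/
def boundaryAngles (Ω : Set ℂ) : Set ℝ :=
  {θ | θ ∈ Ioc (-Real.pi) Real.pi ∧ polarPoint 1 θ ∈ frontier Ω}

theorem measurableSet_boundaryAngles (Ω : Set ℂ) : MeasurableSet (boundaryAngles Ω) :=
  measurableSet_Ioc.inter
    (isClosed_frontier.preimage (continuous_polarPoint_right 1)).measurableSet

/-- The directions in which the radii cross the frontier at distance at least `r` from the centre. -/
def crossingAngles (Ω : Set ℂ) (r : ℝ) : Set ℝ :=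
  {θ | θ ∈ Ioo (-Real.pi) Real.pi ∧ ∃ s ∈ Ico r 1, polarPoint s θ ∈ frontier Ω}

theorem exists_mem_frontier_of_mem_of_notMem {Ω : Set ℂ} (hΩ : IsOpen Ω) {θ r s : ℝ} (hr : r < 1)
    (hs : s ∈ Ico r 1) (h : ¬(polarPoint r θ ∈ Ω ↔ polarPoint s θ ∈ Ω)) :
    ∃ s ∈ Ico r 1, polarPoint s θ ∈ frontier Ω := by
  by_contra hno
  push Not at hno
  have hpre : IsPreconnected ((fun s => polarPoint s θ) '' Ico r 1) :=
    isPreconnected_Ico.image _ (continuous_polarPoint_left θ).continuousOn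
  have hd : Disjoint ((fun s => polarPoint s θ) '' Ico r 1) (frontier Ω) := by
    rw [disjoint_left]
    rintro _ ⟨s, hs, rfl⟩
    exact hno s hs
  have h1 : polarPoint r θ ∈ (fun s => polarPoint s θ) '' Ico r 1 := ⟨r, ⟨le_rfl, hr⟩, rfl⟩
  have h2 : polarPoint s θ ∈ (fun s => polarPoint s θ) '' Ico r 1 := ⟨s, hs, rfl⟩
  exact h ⟨fun h => hpre.subset_of_disjoint_frontier hΩ hd ⟨_, h1, h⟩ h2,
    fun h => hpre.subset_of_disjoint_frontier hΩ hd ⟨_, h2, h⟩ h1⟩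

/-- The boundary angles at which the radius does not finally lie in the set are finitely many. -/
theorem IsArcFrontier.exists_finite_forall_eventually_mem {m : ℕ} {Ω : Set ℂ} {γ : Fin m → ℝ → ℂ}
    (h : IsArcFrontier Ω γ) (hΩ : IsOpen Ω) (hsub : Ω ⊆ Metric.ball 0 1) :
    ∃ F : Set ℝ, F.Finite ∧ ∀ θ ∈ boundaryAngles Ω, θ ∉ F →
      ∀ᶠ s : ℝ in 𝓝[<] 1, polarPoint s θ ∈ Ω := by
  refine ⟨Complex.arg '' arcEndpoints γ, (arcEndpoints_finite γ).image _, fun θ hθ hθF => ?_⟩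
  have := h.eventually_mul_mem hΩ hsub (q := polarPoint 1 θ) (by simp [norm_polarPoint]) hθ.2
    (fun he => hθF ⟨_, he, arg_polarPoint one_pos hθ.1⟩)
  filter_upwards [this] with s hs
  have h2 : polarPoint s θ = polarPoint 1 θ * s := by simp [polarPoint, mul_comm]
  rwa [h2]

/-- If a circle meets the frontier at most once, then at least as many radii cross the frontier
outside of it as there are boundary angles. -/
theorem IsArcFrontier.volume_boundaryAngles_le_crossingAngles {m : ℕ} {Ω : Set ℂ}
    {γ : Fin m → ℝ → ℂ} (h : IsArcFrontier Ω γ) (hΩ : IsOpen Ω) (hsub : Ω ⊆ Metric.ball 0 1)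
    (hvol : volume (boundaryAngles Ω) ≤ ENNReal.ofReal Real.pi) {r : ℝ} (hr : r ∈ Ioo (0 : ℝ) 1)
    (hs : ∀ z ∈ frontier Ω, ∀ w ∈ frontier Ω, ‖z‖ = r → ‖w‖ = r → z = w) :
    volume (boundaryAngles Ω) ≤ volume (crossingAngles Ω r) := by
  obtain ⟨F, hF, hgood⟩ := h.exists_finite_forall_eventually_mem hΩ hsub
  obtain ⟨φ, hin | hout⟩ := circle_subset_or_disjoint_of_subsingleton hΩ hr.1 hs
  -- Circle inside Ω: a radius whose end point is not a boundary point must leave Ω. Such radii have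
  -- measure 2π minus that of the boundary angles, which is enough because the latter is at most π.
  · have hnull : volume ({φ, Real.pi} : Set ℝ) = 0 := ((finite_singleton _).insert _).measure_zero _
    have hsubset : (Ioc (-Real.pi) Real.pi \ boundaryAngles Ω) \ {φ, Real.pi} ⊆
        crossingAngles Ω r := by
      rintro θ ⟨⟨hθ, hθb⟩, hθn⟩
      simp only [mem_insert_iff, mem_singleton_iff, not_or] at hθn
      refine ⟨⟨hθ.1, lt_of_le_of_ne hθ.2 hθn.2⟩, ?_⟩
      have h1 : polarPoint 1 θ ∉ closure Ω := by
        intro hc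
        refine hθb ⟨hθ, ?_⟩
        rw [hΩ.frontier_eq]
        refine ⟨hc, fun hm => ?_⟩
        have := hsub hm
        simp [norm_polarPoint] at this
      have h2 : ∀ᶠ s in 𝓝[<] (1 : ℝ), polarPoint s θ ∉ closure Ω :=
        ((continuous_polarPoint_left θ).continuousAt.eventually_mem
          (isClosed_closure.isOpen_compl.mem_nhds h1)).filter_mono nhdsWithin_le_nhds
      obtain ⟨s, hs, hsr⟩ := (h2.and (Ioo_mem_nhdsLT hr.2)).exists
      refine exists_mem_frontier_of_mem_of_notMem hΩ hr.2 ⟨hsr.1.le, hsr.2⟩ fun hiff => ?_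
      exact hs (subset_closure (hiff.1 (hin θ hθ hθn.1)))
    calc volume (boundaryAngles Ω) ≤ ENNReal.ofReal (2 * Real.pi) - volume (boundaryAngles Ω) := by
          refine ENNReal.le_sub_of_add_le_left (ne_top_of_le_ne_top ENNReal.ofReal_ne_top hvol) ?_
          rw [two_mul, ENNReal.ofReal_add Real.pi_pos.le Real.pi_pos.le]
          exact add_le_add hvol hvol
      _ = volume (Ioc (-Real.pi) Real.pi) - volume (boundaryAngles Ω) := by
          rw [Real.volume_Ioc]; ring_nf
      _ ≤ volume (Ioc (-Real.pi) Real.pi \ boundaryAngles Ω) := le_measure_sdiff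
      _ = volume ((Ioc (-Real.pi) Real.pi \ boundaryAngles Ω) \ {φ, Real.pi}) :=
          (measure_sdiff_null hnull).symm
      _ ≤ _ := measure_mono hsubset
  -- Circle outside Ω: almost every radius towards a boundary angle must enter Ω.
  · have hnull : volume (F ∪ {φ, Real.pi} : Set ℝ) = 0 :=
      (hF.union ((finite_singleton _).insert _)).measure_zero _
    have hsubset : boundaryAngles Ω \ (F ∪ {φ, Real.pi}) ⊆ crossingAngles Ω r := by
      rintro θ ⟨hθ, hθn⟩
      simp only [mem_union, mem_insert_iff, mem_singleton_iff, not_or] at hθn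
      refine ⟨⟨hθ.1.1, lt_of_le_of_ne hθ.1.2 hθn.2.2⟩, ?_⟩
      obtain ⟨s, hs, hsr⟩ := ((hgood θ hθ hθn.1).and (Ioo_mem_nhdsLT hr.2)).exists
      refine exists_mem_frontier_of_mem_of_notMem hΩ hr.2 ⟨hsr.1.le, hsr.2⟩ fun hiff => ?_
      exact hout θ hθ.1 hθn.2.1 (hiff.2 hs)
    calc volume (boundaryAngles Ω) = volume (boundaryAngles Ω \ (F ∪ {φ, Real.pi})) :=
          (measure_sdiff_null hnull).symm
      _ ≤ _ := measure_mono hsubset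

/-! ### The length estimate in an annulus -/

/-- The radial coordinate in which, together with `a` times the angle, curves outside the disk of
radius `a` have `ℓ¹`-speed at most their Euclidean speed. -/
noncomputable def radialCoordinate (a r : ℝ) : ℝ :=
  Real.sqrt (r ^ 2 - a ^ 2) - a * Real.arccos (a / r)

theorem hasDerivAt_radialCoordinate {a r : ℝ} (ha : 0 < a) (hr : a < r) :
    HasDerivAt (radialCoordinate a) (Real.sqrt (r ^ 2 - a ^ 2) / r) r := by
  have hr0 : 0 < r := ha.trans hr
  have hpos : 0 < r ^ 2 - a ^ 2 := by nlinarith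
  have h1 : HasDerivAt (fun r => Real.sqrt (r ^ 2 - a ^ 2)) (r / Real.sqrt (r ^ 2 - a ^ 2)) r := by
    have := ((hasDerivAt_pow 2 r).sub_const (a ^ 2)).sqrt hpos.ne'
    refine this.congr_deriv ?_
    have h7 : 0 < Real.sqrt (r ^ 2 - a ^ 2) := Real.sqrt_pos.2 hpos
    push_cast
    field_simp
  have hlt : a / r < 1 := (div_lt_one hr0).2 hr
  have hgt : -1 < a / r := by linarith [div_pos ha hr0]
  have h2 : HasDerivAt (fun r => a / r) (-a / r ^ 2) r := by
    have := (hasDerivAt_inv hr0.ne').const_mul a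
    refine this.congr_deriv ?_
    ring
  have h3 := (Real.hasDerivAt_arccos hgt.ne' hlt.ne).comp r h2
  have h4 := h1.sub (h3.const_mul a)
  refine h4.congr_deriv ?_
  have h5 : Real.sqrt (1 - (a / r) ^ 2) = Real.sqrt (r ^ 2 - a ^ 2) / r := by
    have : 1 - (a / r) ^ 2 = (r ^ 2 - a ^ 2) / r ^ 2 := by field_simp
    rw [this, Real.sqrt_div hpos.le, Real.sqrt_sq hr0.le]
  rw [h5]
  have h6 := Real.sq_sqrt hpos.le
  have h7 : 0 < Real.sqrt (r ^ 2 - a ^ 2) := Real.sqrt_pos.2 hpos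
  field_simp
  rw [h6]

theorem continuousOn_radialCoordinate {a : ℝ} (ha : 0 < a) :
    ContinuousOn (radialCoordinate a) (Ici a) := by
  unfold radialCoordinate
  refine ContinuousOn.sub (by fun_prop) (continuousOn_const.mul ?_)
  exact Real.continuous_arccos.comp_continuousOn
    (continuousOn_const.div continuousOn_id fun x hx => (ha.trans_le hx).ne')

theorem radialCoordinate_self {a : ℝ} (ha : 0 < a) : radialCoordinate a a = 0 := by
  simp [radialCoordinate, ha.ne']

theorem radialCoordinate_le {a c : ℝ} (ha : 0 < a) (hc : a ≤ c) :
    radialCoordinate a c ≤ c - a := by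
  have := (convex_Icc a c).image_sub_le_mul_sub_of_deriv_le
    ((continuousOn_radialCoordinate ha).mono Icc_subset_Ici_self)
    (fun x hx => ((hasDerivAt_radialCoordinate ha
      (by rw [interior_Icc] at hx; exact hx.1)).differentiableAt.differentiableWithinAt))
    (C := 1) (fun x hx => by
      rw [interior_Icc] at hx
      rw [(hasDerivAt_radialCoordinate ha hx.1).deriv, div_le_one (ha.trans hx.1)]
      exact Real.sqrt_le_iff.2 ⟨(ha.trans hx.1).le, by nlinarith⟩)
    a ⟨le_rfl, hc⟩ c ⟨hc, le_rfl⟩ hc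
  rw [radialCoordinate_self ha] at this
  linarith

/-- Concavity of the sine on [0, π]. It is applied at y = arccos a for the chord bound, and at x =
0, where it gives y cos y ≤ sin y. -/
theorem sin_le_tangent {x y : ℝ} (hx : x ∈ Icc 0 Real.pi) (hy : y ∈ Icc 0 Real.pi) :
    Real.sin x ≤ Real.sin y + (x - y) * Real.cos y := by
  rcases lt_trichotomy x y with h | rfl | h
  · have := strictConcaveOn_sin_Icc.concaveOn.le_slope_of_hasDerivAt hx hy h (Real.hasDerivAt_sin y)
    rw [slope_def_field, le_div_iff₀ (by linarith)] at this
    linarith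
  · simp
  · have := strictConcaveOn_sin_Icc.concaveOn.slope_le_of_hasDerivAt hy hx h (Real.hasDerivAt_sin y)
    rw [slope_def_field, div_le_iff₀ (by linarith)] at this
    linarith

/-- The bound obtained from the angular and radial variation is never worse than a chord. -/
theorem two_mul_sin_le_add_radialCoordinate {a ℓ : ℝ} (ha : 0 < a) (ha1 : a < 1) (hℓ : 0 ≤ ℓ)
    (hℓ2 : ℓ ≤ 2 * Real.pi) :
    2 * Real.sin (ℓ / 2) ≤ a * ℓ + 2 * radialCoordinate a 1 := by
  -- The chord at distance a from the centre subtends the half-angle arccos a. The tangent there has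
  -- slope a and its intercept is exactly `radialCoordinate a 1`.
  have h := sin_le_tangent (x := ℓ / 2) (y := Real.arccos a) ⟨by linarith, by linarith⟩
    ⟨Real.arccos_nonneg a, Real.arccos_le_pi a⟩
  rw [Real.cos_arccos (by linarith) ha1.le, Real.sin_arccos] at h
  rw [radialCoordinate, one_pow, div_one]
  linarith

/-- Both polar velocities come from the logarithmic derivative z'/z: its imaginary part is the
angular velocity, its real part the logarithmic derivative of the radius. -/
theorem hasDerivAt_arg_curve {z : ℝ → ℂ} {z' : ℂ} {t : ℝ} (hz : HasDerivAt z z' t)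
    (h : z t ∈ Complex.slitPlane) : HasDerivAt (fun s => (z s).arg) (z' / z t).im t := by
  have := Complex.imCLM.hasFDerivAt.comp_hasDerivAt t (hz.clog_real h)
  refine this.congr_of_eventuallyEq (Eventually.of_forall fun s => ?_)
  simp [Complex.log_im]

theorem hasDerivAt_norm_curve {z : ℝ → ℂ} {z' : ℂ} {t : ℝ} (hz : HasDerivAt z z' t)
    (h : z t ≠ 0) : HasDerivAt (fun s => ‖z s‖) (‖z t‖ * (z' / z t).re) t := by
  have h1 := hz.norm_sq.sqrt (by simpa using h)
  simp only [Real.sqrt_sq (norm_nonneg _)] at h1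
  convert h1 using 1
  have h2 : ‖z t‖ ≠ 0 := by simpa using h
  have h3 : ‖z t‖ ^ 2 = (z t).re ^ 2 + (z t).im ^ 2 := by
    rw [← Complex.normSq_eq_norm_sq, Complex.normSq_apply]; ring
  rw [Complex.inner, Complex.div_re, Complex.normSq_eq_norm_sq]
  simp only [Complex.mul_re, Complex.conj_re, Complex.conj_im]
  field_simp
  ring

/-- Cauchy–Schwarz for the vectors (a, √(‖z‖² - a²)), of length ‖z‖, and (|Im|, |Re|) of z'/z. The
second term is the velocity of `radialCoordinate a ‖z‖`. -/
theorem angular_add_radial_le_norm {a : ℝ} (ha : 0 ≤ a) {z z' : ℂ} (hz : a < ‖z‖) :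
    a * |(z' / z).im| + |Real.sqrt (‖z‖ ^ 2 - a ^ 2) * (z' / z).re| ≤ ‖z'‖ := by
  have hz0 : 0 < ‖z‖ := ha.trans_lt hz
  have h1 : ‖z'‖ = ‖z‖ * ‖z' / z‖ := by
    rw [norm_div]; field_simp
  set w := z' / z
  have hs : 0 ≤ ‖z‖ ^ 2 - a ^ 2 := by nlinarith
  have h2 : ‖w‖ ^ 2 = w.re ^ 2 + w.im ^ 2 := by
    rw [← Complex.normSq_eq_norm_sq, Complex.normSq_apply]; ring
  rw [h1, abs_mul, abs_of_nonneg (Real.sqrt_nonneg _)]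
  have hS := Real.sq_sqrt hs
  set S := Real.sqrt (‖z‖ ^ 2 - a ^ 2)
  refine abs_le_of_sq_le_sq' ?_ (by positivity) |>.2
  rw [mul_pow, h2, ← sq_abs w.re, ← sq_abs w.im]
  nlinarith [sq_nonneg (a * |w.re| - S * |w.im|)]

/-- Lower bound for the length of the part of the frontier between two circles in terms of the
angles at which it crosses radii and the circles which it meets at least twice. -/
theorem IsArcFrontier.angular_add_radial_le_length {m : ℕ} {Ω : Set ℂ} {γ : Fin m → ℝ → ℂ}
    (h : IsArcFrontier Ω γ) {a c : ℝ} {Ψ : Set ℝ} (ha : 0 < a) (hac : a ≤ c) (hc : c ≤ 1)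
    (hΨ : ∀ θ ∈ Ψ, θ ∈ Ioo (-Real.pi) Real.pi ∧ ∃ s ∈ Ioo a 1, polarPoint s θ ∈ frontier Ω)
    (hdouble : ∀ r ∈ Ioo c 1, ∃ z ∈ frontier Ω, ∃ w ∈ frontier Ω, ‖z‖ = r ∧ ‖w‖ = r ∧ z ≠ w) :
    ENNReal.ofReal a * volume Ψ +
        2 * ENNReal.ofReal (radialCoordinate a 1 - radialCoordinate a c) ≤
      μH[1] (frontier Ω ∩ Metric.ball 0 1) := by
  set A : Fin m → Set ℝ := fun i => Icc 0 1 ∩ {t | a < ‖γ i t‖ ∧ ‖γ i t‖ < 1} with hA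
  have hγc : ∀ i, Continuous (γ i) := fun i => (h.contDiff i).continuous
  have hγd : ∀ i t, HasDerivAt (γ i) (deriv (γ i) t) t := fun i t =>
    ((h.contDiff i).differentiable one_ne_zero t).hasDerivAt
  have hAm : ∀ i, MeasurableSet (A i) := fun i => measurableSet_Icc.inter
    ((isOpen_lt continuous_const (hγc i).norm).inter
      (isOpen_lt (hγc i).norm continuous_const)).measurableSet
  have hparam : ∀ z ∈ frontier Ω, a < ‖z‖ → ‖z‖ < 1 → ∃ i, ∃ t ∈ A i, γ i t = z := by
    intro z hz h1 h2
    rw [h.frontier_eq, mem_iUnion] at hz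
    obtain ⟨i, t, ht, rfl⟩ := hz
    exact ⟨i, t, ⟨ht, h1, h2⟩, rfl⟩
  -- the length dominates the integral of the speed
  have hlen : ∑ i, ∫⁻ t in A i, ‖deriv (γ i) t‖ₑ ≤ μH[1] (frontier Ω ∩ Metric.ball 0 1) := by
    have hm : ∀ i, MeasurableSet (γ i '' A i) := fun i =>
      (hAm i).image_of_continuousOn_injOn (hγc i).continuousOn
        ((h.injOn i).mono inter_subset_left)
    -- Different arcs share at most end points, which have length zero, so the lengths add up.
    have hdisj : Pairwise (Function.onFun (AEDisjoint μH[1]) fun i => γ i '' A i) := by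
      intro i j hij
      have hsub : (γ i '' A i) ∩ (γ j '' A j) ⊆ {γ i 0, γ i 1} := by
        rintro _ ⟨⟨t, ht, rfl⟩, hj⟩
        by_contra hne
        simp only [mem_insert_iff, mem_singleton_iff, not_or] at hne
        refine disjoint_left.1 (h.disjoint i j hij) (mem_image_of_mem _ (x := t) ⟨?_, ?_⟩)
          (image_mono inter_subset_left hj)
        · exact lt_of_le_of_ne ht.1.1 fun h0 => hne.1 (by rw [h0])
        · exact lt_of_le_of_ne ht.1.2 fun h0 => hne.2 (by rw [h0])
      have : NullSingletonClass (μH[1] : Measure ℂ) := Measure.nullSingletonClass_hausdorff ℂ one_pos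
      exact measure_mono_null hsub (((finite_singleton _).insert _).measure_zero _)
    calc ∑ i, ∫⁻ t in A i, ‖deriv (γ i) t‖ₑ ≤ ∑ i, μH[1] (γ i '' A i) :=
          Finset.sum_le_sum fun i _ => lintegral_enorm_deriv_le_hausdorffMeasure_image
            (h.contDiff i) (hAm i) inter_subset_left ((h.injOn i).mono inter_subset_left)
      _ = μH[1] (⋃ i, γ i '' A i) := by
          rw [measure_iUnion₀ hdisj fun i => (hm i).nullMeasurableSet, tsum_fintype]
      _ ≤ _ := by
          refine measure_mono (iUnion_subset fun i => ?_)
          rintro _ ⟨t, ht, rfl⟩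
          refine ⟨?_, by simpa using ht.2.2⟩
          rw [h.frontier_eq]
          exact mem_iUnion.2 ⟨i, t, ht.1, rfl⟩
  refine le_trans ?_ hlen
  have hwm : ∀ i, Measurable fun t => deriv (γ i) t / γ i t := fun i =>
    ((h.contDiff i).continuous_deriv le_rfl).measurable.div (hγc i).measurable
  set ang : Fin m → ℝ → ℝ := fun i t => (deriv (γ i) t / γ i t).im with hang
  set rad : Fin m → ℝ → ℝ := fun i t =>
    Real.sqrt (‖γ i t‖ ^ 2 - a ^ 2) * (deriv (γ i) t / γ i t).re with hrad
  have hangm : ∀ i, Measurable (ang i) := fun i => Complex.measurable_im.comp (hwm i)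
  have hspeed : ∀ i, (ENNReal.ofReal a * ∫⁻ t in A i, ‖ang i t‖ₑ) + ∫⁻ t in A i, ‖rad i t‖ₑ ≤
      ∫⁻ t in A i, ‖deriv (γ i) t‖ₑ := by
    intro i
    rw [← lintegral_const_mul _ (hangm i).enorm,
      ← lintegral_add_left ((hangm i).enorm.const_mul _)]
    refine setLIntegral_mono' (hAm i) fun t ht => ?_
    rw [Real.enorm_eq_ofReal_abs, Real.enorm_eq_ofReal_abs, ← ENNReal.ofReal_mul ha.le,
      ← ENNReal.ofReal_add (by positivity) (abs_nonneg _), ← ofReal_norm]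
    exact ENNReal.ofReal_le_ofReal (angular_add_radial_le_norm ha.le ht.2.1)
  -- The angle π is not in Ψ, so every crossing needed lies in the slit plane, where the argument is
  -- differentiable.
  have hangle : volume Ψ ≤ ∑ i, ∫⁻ t in A i, ‖ang i t‖ₑ := by
    have hsub : Ψ ⊆ ⋃ i, (fun t => (γ i t).arg) '' (A i ∩ γ i ⁻¹' Complex.slitPlane) := by
      intro θ hθ
      obtain ⟨hθI, s, hs, hsf⟩ := hΨ θ hθ
      have hs0 : 0 < s := ha.trans hs.1
      have hn : ‖polarPoint s θ‖ = s := by rw [norm_polarPoint, abs_of_pos hs0]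
      have harg := arg_polarPoint hs0 (Ioo_subset_Ioc_self hθI)
      obtain ⟨i, t, ht, hte⟩ := hparam _ hsf (by rw [hn]; exact hs.1) (by rw [hn]; exact hs.2)
      refine mem_iUnion.2 ⟨i, t, ⟨ht, ?_⟩, by simp only [hte, harg]⟩
      rw [mem_preimage, hte, Complex.mem_slitPlane_iff_arg, harg]
      refine ⟨hθI.2.ne, fun h0 => ?_⟩
      rw [h0, norm_zero] at hn
      exact hs0.ne hn
    calc volume Ψ ≤ ∑ i, volume ((fun t => (γ i t).arg) '' (A i ∩ γ i ⁻¹' Complex.slitPlane)) :=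
          (measure_mono hsub).trans (measure_iUnion_fintype_le _ _)
      _ ≤ ∑ i, ∫⁻ t in A i, ‖ang i t‖ₑ := by
          refine Finset.sum_le_sum fun i _ => ?_
          refine (volume_image_le_lintegral_enorm_deriv (f' := ang i) ((hAm i).inter
            (Complex.isOpen_slitPlane.preimage (hγc i)).measurableSet) fun t ht =>
              hasDerivAt_arg_curve (hγd i t) ht.2).trans ?_
          exact lintegral_mono_set inter_subset_left
  -- The factor 2 comes from multiplicity: each value between the two ends is attained on a circle
  -- that carries two distinct frontier points, hence at two parameters.
  have hradial : 2 * ENNReal.ofReal (radialCoordinate a 1 - radialCoordinate a c) ≤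
      ∑ i, ∫⁻ t in A i, ‖rad i t‖ₑ := by
    rw [← Real.volume_Ioo]
    refine two_mul_volume_le_sum_lintegral (f := fun i t => radialCoordinate a ‖γ i t‖) hAm ?_ ?_
    · intro i t ht
      have hpos : 0 < ‖γ i t‖ := ha.trans ht.2.1
      have := (hasDerivAt_radialCoordinate ha ht.2.1).comp t
        (hasDerivAt_norm_curve (hγd i t) (norm_pos_iff.1 hpos))
      refine this.congr_deriv ?_
      simp only [hrad]
      field_simp
    · intro y hy
      obtain ⟨r, hr, rfl⟩ := intermediate_value_Ioo hc
        ((continuousOn_radialCoordinate ha).mono fun x hx => hac.trans hx.1) hy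
      obtain ⟨z, hz, w, hw, hzr, hwr, hzw⟩ := hdouble r hr
      obtain ⟨i, s, hs, rfl⟩ := hparam z hz (by rw [hzr]; exact hac.trans_lt hr.1)
        (by rw [hzr]; exact hr.2)
      obtain ⟨j, t, ht, rfl⟩ := hparam w hw (by rw [hwr]; exact hac.trans_lt hr.1)
        (by rw [hwr]; exact hr.2)
      refine ⟨i, s, j, t, hs, ht, by simp only [hzr], by simp only [hwr], ?_⟩
      rintro rfl rfl
      exact hzw rfl
  calc _ ≤ ENNReal.ofReal a * (∑ i, ∫⁻ t in A i, ‖ang i t‖ₑ) + ∑ i, ∫⁻ t in A i, ‖rad i t‖ₑ := by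
        gcongr
    _ = ∑ i, ((ENNReal.ofReal a * ∫⁻ t in A i, ‖ang i t‖ₑ) + ∫⁻ t in A i, ‖rad i t‖ₑ) := by
        rw [Finset.mul_sum, Finset.sum_add_distrib]
    _ ≤ _ := Finset.sum_le_sum fun i _ => hspeed i

/-! ### Isoperimetry and the Escobar constants of the disk -/

/-- The relative isoperimetric inequality in the unit disk: the interior boundary is at least as
long as the chord of an arc that is as long as the exterior boundary. -/
theorem IsArcFrontier.two_mul_sin_le_length {m : ℕ} {Ω : Set ℂ} {γ : Fin m → ℝ → ℂ}
    (h : IsArcFrontier Ω γ) (hΩ : IsOpen Ω) (hsub : Ω ⊆ Metric.ball 0 1) {ℓ : ℝ} (hℓ : 0 ≤ ℓ)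
    (hℓπ : ℓ ≤ Real.pi) (hvol : volume (boundaryAngles Ω) = ENNReal.ofReal ℓ) :
    ENNReal.ofReal (2 * Real.sin (ℓ / 2)) ≤ μH[1] (frontier Ω ∩ Metric.ball 0 1) := by
  set S : Set ℝ := {c | c ∈ Icc (0 : ℝ) 1 ∧ ∀ r ∈ Ioo c 1, ∃ z ∈ frontier Ω, ∃ w ∈ frontier Ω,
    ‖z‖ = r ∧ ‖w‖ = r ∧ z ≠ w} with hS
  have h1S : (1 : ℝ) ∈ S := ⟨⟨zero_le_one, le_rfl⟩, by simp⟩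
  have hSbdd : BddBelow S := ⟨0, fun c hc => hc.1.1⟩
  set c₀ := sInf S with hc₀
  have hc₀0 : 0 ≤ c₀ := le_csInf ⟨1, h1S⟩ fun c hc => hc.1.1
  have hc₀1 : c₀ ≤ 1 := csInf_le hSbdd h1S
  have hdouble : ∀ r ∈ Ioo c₀ 1, ∃ z ∈ frontier Ω, ∃ w ∈ frontier Ω,
      ‖z‖ = r ∧ ‖w‖ = r ∧ z ≠ w := by
    intro r hr
    obtain ⟨c, hcS, hcr⟩ := exists_lt_of_csInf_lt ⟨1, h1S⟩ hr.1
    exact hcS.2 r ⟨hcr, hr.2⟩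
  have key : ∀ ε : ℝ, 0 < ε → ε < 1 →
      ENNReal.ofReal (2 * Real.sin (ℓ / 2) - (ℓ + 2) * ε) ≤
        μH[1] (frontier Ω ∩ Metric.ball 0 1) := by
    intro ε hε hε1
    -- The inner radius a must be positive, while c₀ may vanish, so the choice is made up to ε. If
    -- c₀ = 0, the radial term alone suffices with a = c = ε, and discarding the angular term costs
    -- only εℓ. Otherwise a lies just below c = c₀, and the lost radial piece is at most c - a ≤ ε.
    obtain ⟨a, c, Ψ, ha, ha1, hac, hcε, hc, hcc, hΨ, hΨv⟩ : ∃ (a c : ℝ) (Ψ : Set ℝ), 0 < a ∧ a < 1 ∧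
        a ≤ c ∧ c ≤ a + ε ∧ c ≤ 1 ∧ c₀ ≤ c ∧
        (∀ θ ∈ Ψ, θ ∈ Ioo (-Real.pi) Real.pi ∧ ∃ s ∈ Ioo a 1, polarPoint s θ ∈ frontier Ω) ∧
        ENNReal.ofReal ((a - ε) * ℓ) ≤ ENNReal.ofReal a * volume Ψ := by
      rcases hc₀0.eq_or_lt with h0 | h0
      · refine ⟨ε, ε, ∅, hε, hε1, le_rfl, by linarith, hε1.le, by rw [← h0]; exact hε.le, by simp, ?_⟩
        simp
      · set a := max (c₀ / 2) (c₀ - ε) with hadef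
        have ha : 0 < a := lt_max_of_lt_left (by linarith)
        have hac : a < c₀ := max_lt (by linarith) (by linarith)
        -- Since a is below the infimum, some circle beyond a is met at most once, and all crossings
        -- beyond that circle are also beyond a.
        obtain ⟨r, hr, hrS⟩ : ∃ r ∈ Ioo a 1, ∀ z ∈ frontier Ω, ∀ w ∈ frontier Ω,
            ‖z‖ = r → ‖w‖ = r → z = w := by
          by_contra hno
          push Not at hno
          refine absurd (csInf_le hSbdd (show a ∈ S from ⟨⟨ha.le, by linarith⟩, hno⟩)) ?_
          exact not_le.2 hac
        refine ⟨a, c₀, crossingAngles Ω r, ha, by linarith, hac.le, ?_, hc₀1, le_rfl, ?_, ?_⟩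
        · linarith [le_max_right (c₀ / 2) (c₀ - ε)]
        · rintro θ ⟨hθ, s, hs, hsf⟩
          exact ⟨hθ, s, ⟨hr.1.trans_le hs.1, hs.2⟩, hsf⟩
        · have h2 := h.volume_boundaryAngles_le_crossingAngles hΩ hsub
            (by rw [hvol]; exact ENNReal.ofReal_le_ofReal hℓπ) ⟨ha.trans hr.1, hr.2⟩ hrS
          rw [hvol] at h2
          calc ENNReal.ofReal ((a - ε) * ℓ) ≤ ENNReal.ofReal (a * ℓ) :=
                ENNReal.ofReal_le_ofReal (by nlinarith)
            _ = ENNReal.ofReal a * ENNReal.ofReal ℓ := ENNReal.ofReal_mul ha.le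
            _ ≤ _ := by gcongr
    have h3 := h.angular_add_radial_le_length ha hac hc hΨ
      fun r hr => hdouble r ⟨hcc.trans_lt hr.1, hr.2⟩
    refine le_trans ?_ h3
    have h4 := two_mul_sin_le_add_radialCoordinate ha ha1 hℓ (by linarith [Real.pi_pos])
    have h5 := radialCoordinate_le ha hac
    calc ENNReal.ofReal (2 * Real.sin (ℓ / 2) - (ℓ + 2) * ε)
        ≤ ENNReal.ofReal ((a - ε) * ℓ + 2 * (radialCoordinate a 1 - radialCoordinate a c)) :=
          ENNReal.ofReal_le_ofReal (by linarith)
      _ ≤ ENNReal.ofReal ((a - ε) * ℓ) +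
          ENNReal.ofReal (2 * (radialCoordinate a 1 - radialCoordinate a c)) :=
          ENNReal.ofReal_add_le
      _ ≤ _ := by
          rw [ENNReal.ofReal_mul two_pos.le, ENNReal.ofReal_ofNat]
          gcongr
  have hlim : Tendsto (fun ε => ENNReal.ofReal (2 * Real.sin (ℓ / 2) - (ℓ + 2) * ε)) (𝓝[>] 0)
      (𝓝 (ENNReal.ofReal (2 * Real.sin (ℓ / 2)))) := by
    have : Continuous fun ε : ℝ => ENNReal.ofReal (2 * Real.sin (ℓ / 2) - (ℓ + 2) * ε) :=
      ENNReal.continuous_ofReal.comp (by fun_prop)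
    have h0 := this.tendsto 0
    rw [mul_zero, sub_zero] at h0
    exact h0.mono_left nhdsWithin_le_nhds
  refine le_of_tendsto hlim ?_
  filter_upwards [Ioo_mem_nhdsGT one_pos] with ε hε using key ε hε.1 hε.2

/-- Some set of a finite disjoint family of admissible subsets of the disk has few boundary
angles. -/
theorem exists_volume_boundaryAngles_le {k : ℕ} (hk : 0 < k) {Ω : Fin k → Set ℂ} {m : Fin k → ℕ}
    {γ : ∀ j, Fin (m j) → ℝ → ℂ} (h : ∀ j, IsArcFrontier (Ω j) (γ j)) (hΩ : ∀ j, IsOpen (Ω j))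
    (hsub : ∀ j, Ω j ⊆ Metric.ball 0 1) (hdisj : Pairwise fun i j => Disjoint (Ω i) (Ω j)) :
    ∃ j, ∃ ℓ : ℝ, 0 ≤ ℓ ∧ ℓ ≤ 2 * Real.pi / k ∧
      volume (boundaryAngles (Ω j)) = ENNReal.ofReal ℓ := by
  choose F hF hgood using fun j => (h j).exists_finite_forall_eventually_mem (hΩ j) (hsub j)
  have hsubI : ∀ j, boundaryAngles (Ω j) ⊆ Ioc (-Real.pi) Real.pi := fun j θ hθ => hθ.1
  have hvolI : volume (Ioc (-Real.pi) Real.pi) = ENNReal.ofReal (2 * Real.pi) := by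
    rw [Real.volume_Ioc]; ring_nf
  have hfin : ∀ j, volume (boundaryAngles (Ω j)) ≠ ⊤ := fun j =>
    ne_top_of_le_ne_top (by rw [hvolI]; exact ENNReal.ofReal_ne_top) (measure_mono (hsubI j))
  -- At a common angle outside the exceptional sets, the radius would finally lie in both of two
  -- disjoint sets.
  have hae : Pairwise (Function.onFun (AEDisjoint volume) fun j => boundaryAngles (Ω j)) := by
    intro i j hij
    have : boundaryAngles (Ω i) ∩ boundaryAngles (Ω j) ⊆ F i ∪ F j := by
      rintro θ ⟨hi, hj⟩
      by_contra hθ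
      rw [mem_union, not_or] at hθ
      obtain ⟨s, hs1, hs2⟩ := ((hgood i θ hi hθ.1).and (hgood j θ hj hθ.2)).exists
      exact disjoint_left.1 (hdisj hij) hs1 hs2
    exact measure_mono_null this (((hF i).union (hF j)).measure_zero _)
  have hsum : ∑ j, volume (boundaryAngles (Ω j)) ≤ ENNReal.ofReal (2 * Real.pi) := by
    rw [← tsum_fintype (L := .unconditional _), ← measure_iUnion₀ hae
      fun j => (measurableSet_boundaryAngles _).nullMeasurableSet, ← hvolI]
    exact measure_mono (iUnion_subset hsubI)
  have hsum' : ∑ j, (volume (boundaryAngles (Ω j))).toReal ≤ ∑ _j : Fin k, 2 * Real.pi / k := by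
    rw [← ENNReal.toReal_sum fun j _ => hfin j]
    have hk' : (k : ℝ) ≠ 0 := by positivity
    rw [Finset.sum_const, Finset.card_univ, Fintype.card_fin, nsmul_eq_mul,
      mul_div_cancel₀ _ hk']
    exact ENNReal.toReal_le_of_le_ofReal (by positivity) hsum
  have : Nonempty (Fin k) := ⟨⟨0, hk⟩⟩
  obtain ⟨j, -, hj⟩ := Finset.exists_le_of_sum_le Finset.univ_nonempty hsum'
  exact ⟨j, _, ENNReal.toReal_nonneg, hj, (ENNReal.ofReal_toReal (hfin j)).symm⟩

/-- The exterior boundary in the disk is not longer than the set of boundary angles. -/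
theorem hausdorffMeasure_frontier_inter_sphere_le (Ω : Set ℂ) :
    μH[1] (frontier Ω ∩ Metric.sphere 0 1) ≤ volume (boundaryAngles Ω) := by
  have hlip : LipschitzWith 1 (polarPoint 1) := by
    refine lipschitzWith_of_nnnorm_deriv_le (𝕜 := ℝ) (fun θ => ?_) fun θ => ?_
    · unfold polarPoint; fun_prop
    · have : HasDerivAt (polarPoint 1) (Complex.exp (θ * Complex.I) * Complex.I) θ := by
        have h1 : HasDerivAt (fun t : ℝ => (t : ℂ) * Complex.I) Complex.I θ := by
          simpa using Complex.ofRealCLM.hasDerivAt.mul_const Complex.I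
        have h2 := h1.cexp
        refine h2.congr_of_eventuallyEq (Eventually.of_forall fun t => ?_)
        simp [polarPoint]
      rw [this.deriv, ← NNReal.coe_le_coe]
      simp
  have hsub : frontier Ω ∩ Metric.sphere 0 1 ⊆ polarPoint 1 '' boundaryAngles Ω := by
    rintro z ⟨hz, hz1⟩
    have hp : polarPoint 1 z.arg = z := by
      rw [mem_sphere_zero_iff_norm] at hz1
      rw [← hz1]
      exact polarPoint_norm_arg z
    exact ⟨z.arg, ⟨Complex.arg_mem_Ioc z, by rwa [hp]⟩, hp⟩
  calc μH[1] (frontier Ω ∩ Metric.sphere 0 1) ≤ μH[1] (polarPoint 1 '' boundaryAngles Ω) :=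
        measure_mono hsub
    _ ≤ ((1 : NNReal) : ℝ≥0∞) ^ (1 : ℝ) * μH[1] (boundaryAngles Ω) :=
        hlip.hausdorffMeasure_image_le zero_le_one _
    _ = volume (boundaryAngles Ω) := by simp [hausdorffMeasure_real]

/-- Lower bound for the Escobar constants of the disk. -/
theorem le_escobarConstant_unitDisk {k : ℕ} (hk : 2 ≤ k) {c : ℝ} (hc0 : 0 ≤ c)
    (hc : ∀ x ∈ Icc 0 (Real.pi / k), c * x ≤ Real.sin x) :
    ENNReal.ofReal c ≤ escobarConstant k unitDisk := by
  refine le_iInf₂ fun Ω ⟨hadm, hdisj⟩ => ?_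
  set e : ℂ ≃ₗᵢ[ℝ] Plane := Complex.orthonormalBasisOneI.repr with he
  have hfr : ∀ S : Set Plane, frontier (e ⁻¹' S) = e ⁻¹' frontier S := fun S =>
    (e.toHomeomorph.preimage_frontier S).symm
  have hlen : ∀ S : Set Plane, planeLength S = μH[1] (e ⁻¹' S) := fun S =>
    (e.toIsometryEquiv.hausdorffMeasure_preimage 1 S).symm
  have hball : e ⁻¹' unitDisk = Metric.ball 0 1 := by
    ext z; simp [unitDisk]
  have hsphere : e ⁻¹' frontier unitDisk = Metric.sphere 0 1 := by
    rw [← hfr, hball, frontier_ball _ one_ne_zero]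
  choose m γ hγ hγd hγf using fun j => (hadm j).boundary
  have harc : ∀ j, IsArcFrontier (e ⁻¹' Ω j) fun i t => e.symm (γ j i t) := by
    intro j
    have hder : ∀ i t, deriv (fun t => e.symm (γ j i t)) t = e.symm (deriv (γ j i) t) := by
      intro i t
      have h1 : HasDerivAt (γ j i) (deriv (γ j i) t) t :=
        (((hγ j i).contDiff.differentiable (by simp)) t).hasDerivAt
      exact (e.symm.toContinuousLinearEquiv.hasFDerivAt.comp_hasDerivAt t h1).deriv
    refine ⟨fun i => ?_, fun i t ht => ?_, fun i => ?_, fun i i' hi => ?_, ?_⟩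
    · exact e.symm.contDiff.comp ((hγ j i).contDiff.of_le (by exact_mod_cast le_top))
    · rw [hder]
      simpa using (hγ j i).deriv_ne_zero t ht
    · exact e.symm.injective.comp_injOn (hγ j i).injOn
    · have := (disjoint_image_iff e.symm.injective).2 (hγd j i i' hi)
      rwa [image_image, image_image] at this
    · rw [hfr, hγf j, preimage_iUnion]
      refine iUnion_congr fun i => ?_
      rw [← image_image (fun z => e.symm z) (γ j i)]
      ext z
      simp [LinearIsometryEquiv.eq_symm_apply, eq_comm]
  have hopen : ∀ j, IsOpen (e ⁻¹' Ω j) := fun j => (hadm j).isOpen.preimage e.continuous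
  have hsub : ∀ j, e ⁻¹' Ω j ⊆ Metric.ball 0 1 := fun j => by
    rw [← hball]; exact preimage_mono (hadm j).subset
  obtain ⟨j, ℓ, hℓ, hℓk, hvol⟩ := exists_volume_boundaryAngles_le (by lia) harc hopen hsub
    fun i j hij => (hdisj hij).preimage _
  refine le_trans ?_ (le_iSup _ j)
  rw [isoperimetricRatio]
  split_ifs with h0
  · exact le_top
  have hk2 : (2 : ℝ) ≤ k := by exact_mod_cast hk
  have hℓπ : ℓ ≤ Real.pi := hℓk.trans (by
    rw [div_le_iff₀ (by linarith)]; nlinarith [Real.pi_pos])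
  have hint := (harc j).two_mul_sin_le_length (hopen j) (hsub j) hℓ hℓπ hvol
  have hext := hausdorffMeasure_frontier_inter_sphere_le (e ⁻¹' Ω j)
  have hint' : planeLength (interiorBoundary unitDisk (Ω j)) =
      μH[1] (frontier (e ⁻¹' Ω j) ∩ Metric.ball 0 1) := by
    rw [hlen, interiorBoundary, preimage_inter, hball, hfr]
  have hext' : planeLength (exteriorBoundary unitDisk (Ω j)) =
      μH[1] (frontier (e ⁻¹' Ω j) ∩ Metric.sphere 0 1) := by
    rw [hlen, exteriorBoundary, preimage_inter, hsphere, hfr]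
  rw [← hext', hvol] at hext
  rw [← hint'] at hint
  rw [ENNReal.le_div_iff_mul_le (Or.inl h0)
    (Or.inl (ne_top_of_le_ne_top ENNReal.ofReal_ne_top hext))]
  calc ENNReal.ofReal c * planeLength (exteriorBoundary unitDisk (Ω j))
      ≤ ENNReal.ofReal c * ENNReal.ofReal ℓ := by gcongr
    _ = ENNReal.ofReal (c * ℓ) := (ENNReal.ofReal_mul hc0).symm
    _ ≤ ENNReal.ofReal (2 * Real.sin (ℓ / 2)) := by
        refine ENNReal.ofReal_le_ofReal ?_
        have := hc (ℓ / 2) ⟨by linarith, by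
          rw [div_le_iff₀ two_pos]; exact hℓk.trans_eq (by ring)⟩
        linarith
    _ ≤ _ := hint

/-- For n ≤ k, sin x ≥ x cos x ≥ x cos(π/n) on [0, π/k]. The only remaining case is n = 4, k = 3,
where the chord of the sine over [0, π/3] has slope 3√3/(2π) > √2/2. -/
theorem cos_pi_div_le_escobarConstant_unitDisk {n k : ℕ} (hn : 3 ≤ n) (hk : 3 ≤ k)
    (h : n ≤ k ∨ n ≤ 4) :
    ENNReal.ofReal (Real.cos (Real.pi / n)) ≤ escobarConstant k unitDisk := by
  have hn' : (3 : ℝ) ≤ n := by exact_mod_cast hn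
  have hk' : (3 : ℝ) ≤ k := by exact_mod_cast hk
  have hπ := Real.pi_pos
  have hk3 : Real.pi / k ≤ Real.pi / 3 := div_le_div_of_nonneg_left hπ.le (by norm_num) hk'
  have hn3 : Real.pi / n ≤ Real.pi / 3 := div_le_div_of_nonneg_left hπ.le (by norm_num) hn'
  have hn0 : 0 ≤ Real.pi / n := by positivity
  have hcos0 : 0 ≤ Real.cos (Real.pi / n) :=
    Real.cos_nonneg_of_neg_pi_div_two_le_of_le (by linarith) (by linarith)
  refine le_escobarConstant_unitDisk (by lia) hcos0 fun x hx => ?_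
  by_cases hnk : n ≤ k
  · have hkn : Real.pi / k ≤ Real.pi / n :=
      div_le_div_of_nonneg_left hπ.le (by linarith) (by exact_mod_cast hnk)
    have h1 : Real.cos (Real.pi / n) ≤ Real.cos x :=
      Real.cos_le_cos_of_nonneg_of_le_pi hx.1 (by linarith) (hx.2.trans hkn)
    have h2 := sin_le_tangent (x := 0) (y := x) ⟨le_rfl, hπ.le⟩ ⟨hx.1, by linarith [hx.2]⟩
    rw [Real.sin_zero] at h2
    nlinarith [hx.1]
  · obtain rfl : n = 4 := by lia
    have h1 : Real.cos (Real.pi / (4 : ℕ)) = Real.sqrt 2 / 2 := by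
      push_cast; exact Real.cos_pi_div_four
    rw [h1]
    have hx3 : x ≤ Real.pi / 3 := hx.2.trans hk3
    -- the sine lies above its chord on `[0, π / 3]`
    have h2 : Real.sqrt 3 / 2 * (x / (Real.pi / 3)) ≤ Real.sin x := by
      have hl0 : 0 ≤ x / (Real.pi / 3) := div_nonneg hx.1 (by positivity)
      have hl1 : x / (Real.pi / 3) ≤ 1 := (div_le_one (by positivity)).2 hx3
      have := strictConcaveOn_sin_Icc.concaveOn.2 (x := 0) ⟨le_rfl, hπ.le⟩
        (y := Real.pi / 3) ⟨by positivity, by linarith⟩ (sub_nonneg.2 hl1) hl0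
        (sub_add_cancel _ _)
      simp only [Real.sin_zero, Real.sin_pi_div_three, smul_eq_mul, mul_zero, zero_add] at this
      rw [div_mul_cancel₀ _ (by positivity)] at this
      linarith
    refine le_trans ?_ h2
    have h3 : Real.sqrt 2 * Real.pi ≤ 3 * Real.sqrt 3 := by
      have hs2 : Real.sqrt 2 < 1.4143 := by
        rw [Real.sqrt_lt' (by norm_num)]; norm_num
      have hs3 : 1.732 < Real.sqrt 3 := by
        rw [Real.lt_sqrt (by norm_num)]; norm_num
      nlinarith [Real.pi_lt_d2, Real.sqrt_nonneg 2]
    have h4 : Real.sqrt 3 / 2 * (x / (Real.pi / 3)) = (3 * Real.sqrt 3) * (x / (2 * Real.pi)) := by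
      field_simp
    rw [h4]
    calc Real.sqrt 2 / 2 * x = Real.sqrt 2 * Real.pi * (x / (2 * Real.pi)) := by field_simp
      _ ≤ _ := mul_le_mul_of_nonneg_right h3 (div_nonneg hx.1 (by positivity))

/-! ### Normal directions and a vertex with small interior angle -/

/-- Sets of angles that are periodic have the same measure in all windows of length `2π`. -/
theorem volume_inter_Ioc_eq_of_periodic {T : Set ℝ} (hm : MeasurableSet T)
    (hT : ∀ (k : ℤ) (x : ℝ), x + k * (2 * Real.pi) ∈ T ↔ x ∈ T) (a : ℝ) :
    volume (T ∩ Ioc (-Real.pi) Real.pi) = volume (T ∩ Ioc a (a + 2 * Real.pi)) := by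
  have h1 := isAddFundamentalDomain_Ioc Real.two_pi_pos (-Real.pi)
  have h2 := isAddFundamentalDomain_Ioc Real.two_pi_pos a
  rw [show -Real.pi + 2 * Real.pi = Real.pi by ring] at h1
  refine h1.measure_set_eq h2 hm ?_
  rintro ⟨_, k, rfl⟩
  ext x
  have := hT k x
  rw [← this]
  simp [AddSubgroup.vadd_def, add_comm]

theorem mem_Icc_of_cos_nonpos {x : ℝ} (hx : x ∈ Ioc 0 (2 * Real.pi)) (h : Real.cos x ≤ 0) :
    x ∈ Icc (Real.pi / 2) (3 * Real.pi / 2) := by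
  constructor
  · by_contra! hlt
    exact absurd (Real.cos_pos_of_mem_Ioo ⟨by linarith [hx.1, Real.pi_pos], hlt⟩) (not_lt.2 h)
  · by_contra! hlt
    have := Real.cos_pos_of_mem_Ioo (x := x - 2 * Real.pi) ⟨by linarith, by linarith [hx.2, Real.pi_pos]⟩
    rw [Real.cos_sub_two_pi] at this
    linarith

/-- The polar of a set of directions of measure at least `δ > 0` has measure at most `π - δ`. -/
theorem volume_polar_directions_le {N : Set ℝ} (hNm : MeasurableSet N)
    (hN : ∀ (k : ℤ) (x : ℝ), x + k * (2 * Real.pi) ∈ N ↔ x ∈ N) {δ : ℝ} (hδ : 0 < δ)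
    (hvol : ENNReal.ofReal δ ≤ volume (N ∩ Ioc (-Real.pi) Real.pi)) :
    volume ({φ | ∀ u ∈ N, Real.cos (φ - u) ≤ 0} ∩ Ioc (-Real.pi) Real.pi) ≤
      ENNReal.ofReal (Real.pi - δ) := by
  set C : Set ℝ := {φ | ∀ u ∈ N, Real.cos (φ - u) ≤ 0} with hC
  have hCm : MeasurableSet C := by
    have : C = ⋂ u ∈ N, {φ | Real.cos (φ - u) ≤ 0} := by ext; simp [hC]
    rw [this]
    exact (isClosed_biInter fun u _ => isClosed_le (by fun_prop) continuous_const).measurableSet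
  have hCp : ∀ (k : ℤ) (x : ℝ), x + k * (2 * Real.pi) ∈ C ↔ x ∈ C := by
    intro k x
    refine forall₂_congr fun u _ => ?_
    rw [show x + k * (2 * Real.pi) - u = x - u + k * (2 * Real.pi) by ring,
      Real.cos_add_int_mul_two_pi]
  rcases C.eq_empty_or_nonempty with h | ⟨φ₀, hφ₀⟩
  · simp [h]
  have key : ∀ d ∈ Ioo 0 δ, volume (C ∩ Ioc (-Real.pi) Real.pi) ≤ ENNReal.ofReal (Real.pi - d) := by
    rintro d ⟨hd0, hd⟩
    rw [volume_inter_Ioc_eq_of_periodic hNm hN φ₀] at hvol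
    have hsub : ∀ u ∈ N ∩ Ioc φ₀ (φ₀ + 2 * Real.pi), u - φ₀ ∈ Icc (Real.pi / 2) (3 * Real.pi / 2) :=
      fun u hu => mem_Icc_of_cos_nonpos ⟨by linarith [hu.2.1], by linarith [hu.2.2]⟩
        (by rw [← Real.cos_neg, neg_sub]; exact hφ₀ u hu.1)
    -- A set of measure greater than d has diameter greater than d. Starting the window at a polar
    -- direction φ₀ puts all normals into one half-circle, so differences of representatives are
    -- true angles.
    obtain ⟨u₁, hu₁, u₂, hu₂, hlt⟩ : ∃ u₁ ∈ N ∩ Ioc φ₀ (φ₀ + 2 * Real.pi),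
        ∃ u₂ ∈ N ∩ Ioc φ₀ (φ₀ + 2 * Real.pi), d < u₂ - u₁ := by
      by_contra! hno
      have h1 : volume (N ∩ Ioc φ₀ (φ₀ + 2 * Real.pi)) ≤ ENNReal.ofReal d := by
        refine (Real.volume_le_diam _).trans (Metric.ediam_le fun x hx y hy => ?_)
        rw [edist_dist, Real.dist_eq]
        exact ENNReal.ofReal_le_ofReal (abs_sub_le_iff.2 ⟨hno y hy x hx, hno x hx y hy⟩)
      exact absurd (hvol.trans h1)
        (not_le.2 ((ENNReal.ofReal_lt_ofReal_iff hδ).2 hd))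
    rw [volume_inter_Ioc_eq_of_periodic hCm hCp u₁]
    have hdiff : u₂ - u₁ ≤ Real.pi := by
      have h1 := (hsub u₁ hu₁).1
      have h2 := (hsub u₂ hu₂).2
      linarith
    -- Two half-circles whose centres differ by u₂ - u₁ ≤ π overlap in an arc of length π - (u₂ -
    -- u₁). The extra point accounts for the case u₂ - u₁ = π, when they also touch at the other
    -- end.
    have hsub2 : C ∩ Ioc u₁ (u₁ + 2 * Real.pi) ⊆
        {u₁ + Real.pi / 2} ∪ Icc (u₂ + Real.pi / 2) (u₁ + 3 * Real.pi / 2) := by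
      rintro φ ⟨hφ, hφ1, hφ2⟩
      have h1 := mem_Icc_of_cos_nonpos (x := φ - u₁) ⟨by linarith, by linarith⟩ (hφ u₁ hu₁.1)
      by_cases heq : φ = u₁ + Real.pi / 2
      · exact Or.inl heq
      · right
        refine ⟨?_, by linarith [h1.2]⟩
        by_contra! hlt2
        have h2 : u₁ + Real.pi / 2 < φ := lt_of_le_of_ne (by linarith [h1.1]) (Ne.symm heq)
        exact absurd (Real.cos_pos_of_mem_Ioo (x := φ - u₂) ⟨by linarith, by linarith⟩)
          (not_lt.2 (hφ u₂ hu₂.1))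
    calc volume (C ∩ Ioc u₁ (u₁ + 2 * Real.pi))
        ≤ volume {u₁ + Real.pi / 2} + volume (Icc (u₂ + Real.pi / 2) (u₁ + 3 * Real.pi / 2)) :=
          (measure_mono hsub2).trans (measure_union_le _ _)
      _ ≤ _ := by
          rw [Real.volume_singleton, zero_add, Real.volume_Icc]
          exact ENNReal.ofReal_le_ofReal (by linarith)
  have hlim : Tendsto (fun d => ENNReal.ofReal (Real.pi - d)) (𝓝[<] δ)
      (𝓝 (ENNReal.ofReal (Real.pi - δ))) := by
    have : Continuous fun d : ℝ => ENNReal.ofReal (Real.pi - d) :=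
      ENNReal.continuous_ofReal.comp (by fun_prop)
    exact (this.tendsto δ).mono_left nhdsWithin_le_nhds
  refine ge_of_tendsto hlim ?_
  filter_upwards [Ioo_mem_nhdsLT hδ] with d hd using key d hd

/-- The unit vector with polar angle `φ`. -/
noncomputable def planeDir (φ : ℝ) : Plane := !₂[Real.cos φ, Real.sin φ]

@[simp] theorem planeDir_zero (φ : ℝ) : planeDir φ 0 = Real.cos φ := rfl
@[simp] theorem planeDir_one (φ : ℝ) : planeDir φ 1 = Real.sin φ := rfl

theorem plane_inner (x y : Plane) : inner ℝ x y = x 0 * y 0 + x 1 * y 1 := by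
  simp [PiLp.inner_apply, Fin.sum_univ_two, mul_comm]

theorem inner_planeDir (u φ : ℝ) : inner ℝ (planeDir u) (planeDir φ) = Real.cos (φ - u) := by
  rw [plane_inner, Real.cos_sub]; simp [mul_comm]

theorem norm_planeDir (φ : ℝ) : ‖planeDir φ‖ = 1 := by
  rw [EuclideanSpace.norm_eq]; simp [Fin.sum_univ_two]

theorem continuous_planeDir : Continuous planeDir := by
  unfold planeDir
  refine (PiLp.continuous_toLp 2 _).comp (continuous_pi fun i => ?_)
  fin_cases i
  · exact Real.continuous_cos
  · exact Real.continuous_sin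

theorem planeDir_add_int_mul_two_pi (φ : ℝ) (k : ℤ) :
    planeDir (φ + k * (2 * Real.pi)) = planeDir φ := by
  unfold planeDir
  rw [Real.cos_add_int_mul_two_pi, Real.sin_add_int_mul_two_pi]

theorem planeDir_add_two_pi (φ : ℝ) : planeDir (φ + 2 * Real.pi) = planeDir φ := by
  simpa using planeDir_add_int_mul_two_pi φ 1

theorem planeDir_ne_of_lt_of_lt {φ ψ : ℝ} (h1 : φ < ψ) (h2 : ψ < φ + 2 * Real.pi) :
    planeDir φ ≠ planeDir ψ := by
  intro h
  have h3 := inner_planeDir φ ψ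
  rw [h, real_inner_self_eq_norm_sq, norm_planeDir, one_pow] at h3
  have h4 := (Real.cos_eq_one_iff_of_lt_of_lt (by linarith) (by linarith)).1 h3.symm
  linarith

/-- The window for the angle is free, so that angles can be measured from a given ray and compared
as real numbers. -/
theorem exists_eq_norm_smul_planeDir (v : Plane) (a : ℝ) :
    ∃ φ ∈ Ioc a (a + 2 * Real.pi), v = ‖v‖ • planeDir φ := by
  set z : ℂ := ⟨v 0, v 1⟩ with hz
  have hn : ‖v‖ = ‖z‖ := by
    rw [EuclideanSpace.norm_eq, Complex.norm_eq_sqrt_sq_add_sq]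
    simp [Fin.sum_univ_two, hz]
  have hv : v = ‖v‖ • planeDir z.arg := by
    ext i
    fin_cases i
    · simp [hn, hz]
    · simp [hn, hz]
  obtain ⟨k, hk, -⟩ := existsUnique_add_zsmul_mem_Ioc Real.two_pi_pos z.arg a
  refine ⟨_, hk, ?_⟩
  rw [zsmul_eq_mul, planeDir_add_int_mul_two_pi]
  exact hv

/-- A linear functional that attains its maximum over the vertices at `p` is bounded by its value
at `p` on the domain enclosed by the polygon. -/
theorem IsEuclideanPolygon.inner_sub_nonpos {n : ℕ} {P : Polygon Plane n} {M : Set Plane}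
    (hM : IsEuclideanPolygon P M) {p u : Plane} (hu : u ≠ 0)
    (h : ∀ i, inner ℝ u (P i - p) ≤ 0) {x : Plane} (hx : x ∈ M) : inner ℝ u (x - p) ≤ 0 := by
  by_contra! hpos
  have hbd : ∀ y ∈ frontier M, inner ℝ u (y - p) ≤ 0 := by
    intro y hy
    rw [hM.frontier_eq, Polygon.boundary, mem_iUnion] at hy
    obtain ⟨i, t, ht, rfl⟩ := hy
    have h1 := h i
    have h2 := h (finRotate n i)
    have h3 : AffineMap.lineMap (P i) (P (finRotate n i)) t - p =
        (1 - t) • (P i - p) + t • (P (finRotate n i) - p) := by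
      rw [AffineMap.lineMap_apply_module]
      module
    rw [h3, inner_add_right, inner_smul_right, inner_smul_right]
    nlinarith [ht.1, ht.2]
  -- The functional is non-positive on the polygon but positive all along this ray, so the ray stays
  -- in M, contrary to boundedness.
  set R : Set Plane := (fun t : ℝ => x + t • u) '' Ici 0 with hR
  have hpre : IsPreconnected R :=
    isPreconnected_Ici.image _ (by fun_prop)
  have hd : Disjoint R (frontier M) := by
    rw [disjoint_left]
    rintro _ ⟨t, ht, rfl⟩ hf
    have h1 := hbd _ hf
    simp only at h1
    rw [add_sub_right_comm, inner_add_right, inner_smul_right, real_inner_self_eq_norm_sq] at h1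
    have : 0 ≤ t * ‖u‖ ^ 2 := mul_nonneg ht (by positivity)
    linarith
  have hsub : R ⊆ M := hpre.subset_of_disjoint_frontier hM.isOpen hd
    ⟨x, ⟨0, self_mem_Ici, by simp⟩, hx⟩
  obtain ⟨C, hC⟩ := hM.isBounded.exists_norm_le
  have hu0 : 0 < ‖u‖ := norm_pos_iff.2 hu
  have hC0 : 0 ≤ C := (norm_nonneg _).trans (hC x hx)
  have h1 := hC _ (hsub ⟨(C + ‖x‖ + 1) / ‖u‖, by simp only [mem_Ici]; positivity, rfl⟩)
  have h2 : ‖((C + ‖x‖ + 1) / ‖u‖) • u‖ = C + ‖x‖ + 1 := by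
    rw [norm_smul, Real.norm_of_nonneg (by positivity), div_mul_cancel₀ _ hu0.ne']
  have h3 := norm_sub_le (x + ((C + ‖x‖ + 1) / ‖u‖) • u) x
  rw [add_sub_cancel_left, h2] at h3
  simp only at h1
  linarith

/-- A polygon has a vertex with interior angle at most `π - 2π/n`. -/
theorem IsEuclideanPolygon.exists_interiorAngle_le {n : ℕ} {P : Polygon Plane n} {M : Set Plane}
    (hM : IsEuclideanPolygon P M) :
    ∃ i, interiorAngle M (P i) ≤ Real.pi - 2 * Real.pi / n := by
  have hn : (3 : ℝ) ≤ n := by exact_mod_cast hM.simple.three_le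
  have hπ := Real.pi_pos
  have : Nonempty (Fin n) := ⟨⟨0, by have := hM.simple.three_le; lia⟩⟩
  -- The outer normals of the convex hull at each vertex. The n sets cover the circle, and the
  -- average yields one of measure at least 2π/n.
  set N : Fin n → Set ℝ := fun i => {φ | ∀ j, inner ℝ (planeDir φ) (P j - P i) ≤ 0} with hN
  have hNm : ∀ i, MeasurableSet (N i) := by
    intro i
    have : N i = ⋂ j, {φ | inner ℝ (planeDir φ) (P j - P i) ≤ 0} := by ext; simp [hN]
    rw [this]
    exact (isClosed_iInter fun j => isClosed_le
      (continuous_planeDir.inner continuous_const) continuous_const).measurableSet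
  have hNp : ∀ i, ∀ (k : ℤ) (x : ℝ), x + k * (2 * Real.pi) ∈ N i ↔ x ∈ N i := by
    intro i k x
    simp only [hN, mem_ofPred_eq, planeDir_add_int_mul_two_pi]
  have hcover : ∀ φ, ∃ i, φ ∈ N i := by
    intro φ
    obtain ⟨i, hi⟩ := Finite.exists_max fun j => inner ℝ (planeDir φ) (P j)
    exact ⟨i, fun j => by rw [inner_sub_right]; linarith [hi j]⟩
  have hfin : ∀ i, volume (N i ∩ Ioc (-Real.pi) Real.pi) ≠ ⊤ := fun i =>
    ne_top_of_le_ne_top (measure_Ioc_lt_top (a := -Real.pi) (b := Real.pi)).ne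
      (measure_mono inter_subset_right)
  obtain ⟨i, hi⟩ : ∃ i, 2 * Real.pi / n ≤ (volume (N i ∩ Ioc (-Real.pi) Real.pi)).toReal := by
    have hsum : ∑ _i : Fin n, 2 * Real.pi / n ≤
        ∑ i, (volume (N i ∩ Ioc (-Real.pi) Real.pi)).toReal := by
      rw [← ENNReal.toReal_sum fun j _ => hfin j]
      rw [Finset.sum_const, Finset.card_univ, Fintype.card_fin, nsmul_eq_mul,
        mul_div_cancel₀ _ (by positivity)]
      have h1 : volume (Ioc (-Real.pi) Real.pi) ≤
          ∑ i, volume (N i ∩ Ioc (-Real.pi) Real.pi) := by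
        refine le_trans (measure_mono fun φ hφ => ?_) (measure_iUnion_fintype_le _ _)
        obtain ⟨i, hi⟩ := hcover φ
        exact mem_iUnion.2 ⟨i, hi, hφ⟩
      have h2 := ENNReal.toReal_mono (ENNReal.sum_ne_top.2 fun i _ => hfin i) h1
      rw [Real.volume_Ioc, ENNReal.toReal_ofReal (by linarith)] at h2
      linarith
    obtain ⟨i, -, hi⟩ := Finset.exists_le_of_sum_le Finset.univ_nonempty hsum
    exact ⟨i, hi⟩
  have hnn : 2 * Real.pi / n ≤ Real.pi := by
    rw [div_le_iff₀ (by linarith)]; nlinarith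
  refine ⟨i, ENNReal.toReal_le_of_le_ofReal (by linarith) ?_⟩
  refine le_trans (measure_mono ?_) (volume_polar_directions_le (hNm i) (hNp i)
    (δ := 2 * Real.pi / n) (by positivity) ((ENNReal.ofReal_le_iff_le_toReal (hfin i)).2 hi))
  rintro φ ⟨hφ, r, hr, hrM⟩
  refine ⟨fun u hu => ?_, hφ⟩
  have h1 := hM.inner_sub_nonpos (u := planeDir u)
    (norm_ne_zero_iff.1 (by rw [norm_planeDir]; exact one_ne_zero)) hu
    (hrM (r / 2) ⟨by linarith, by linarith⟩)
  rw [add_sub_cancel_left, inner_smul_right] at h1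
  have h2 : inner ℝ (planeDir u) !₂[Real.cos φ, Real.sin φ] = Real.cos (φ - u) :=
    inner_planeDir u φ
  rw [h2] at h1
  by_contra! h3
  nlinarith [mul_pos (half_pos hr) h3]

/-! ### Trapezoids in a sector -/

/-- The affine coordinates of the plane with origin `p` and axes in the directions `α` and `β`. -/
noncomputable def obliqueCoordinates (p : Plane) {α β : ℝ} (h : Real.sin (β - α) ≠ 0) :
    ℝ × ℝ ≃ₜ Plane where
  toFun q := p + q.1 • planeDir α + q.2 • planeDir β
  invFun x := (((x 0 - p 0) * Real.sin β - (x 1 - p 1) * Real.cos β) / Real.sin (β - α),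
    ((x 1 - p 1) * Real.cos α - (x 0 - p 0) * Real.sin α) / Real.sin (β - α))
  left_inv := by
    rintro ⟨s, t⟩
    have h' := h
    rw [Real.sin_sub] at h'
    ext
    · simp only [PiLp.add_apply, PiLp.smul_apply, planeDir_zero, planeDir_one, smul_eq_mul]
      rw [div_eq_iff h, Real.sin_sub]; ring
    · simp only [PiLp.add_apply, PiLp.smul_apply, planeDir_zero, planeDir_one, smul_eq_mul]
      rw [div_eq_iff h, Real.sin_sub]; ring
  right_inv := by
    intro x
    ext i
    fin_cases i
    · simp only [Fin.zero_eta, PiLp.add_apply, PiLp.smul_apply, planeDir_zero, smul_eq_mul]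
      field_simp
      rw [Real.sin_sub]; ring
    · simp only [Fin.mk_one, PiLp.add_apply, PiLp.smul_apply, planeDir_one, smul_eq_mul]
      field_simp
      rw [Real.sin_sub]; ring
  continuous_toFun := by fun_prop
  continuous_invFun := by fun_prop

theorem obliqueCoordinates_apply (p : Plane) {α β : ℝ} (h : Real.sin (β - α) ≠ 0) (s t : ℝ) :
    obliqueCoordinates p h (s, t) = p + s • planeDir α + t • planeDir β := rfl

/-- The model trapezoid. -/
def modelTrapezoid (b c : ℝ) : Set (ℝ × ℝ) := {q | 0 < q.1 ∧ 0 < q.2 ∧ b < q.1 + q.2 ∧ q.1 + q.2 < c}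

theorem isOpen_modelTrapezoid (b c : ℝ) : IsOpen (modelTrapezoid b c) :=
  (isOpen_lt continuous_const continuous_fst).inter ((isOpen_lt continuous_const continuous_snd).inter
    ((isOpen_lt continuous_const (continuous_fst.add continuous_snd)).inter
      (isOpen_lt (continuous_fst.add continuous_snd) continuous_const)))

theorem closure_modelTrapezoid {b c : ℝ} (hb : 0 < b) (hbc : b < c) :
    closure (modelTrapezoid b c) =
      {q | 0 ≤ q.1 ∧ 0 ≤ q.2 ∧ b ≤ q.1 + q.2 ∧ q.1 + q.2 ≤ c} := by
  refine Subset.antisymm (closure_minimal (fun q hq => ⟨hq.1.le, hq.2.1.le, hq.2.2.1.le, hq.2.2.2.le⟩) ?_) ?_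
  · exact (isClosed_le continuous_const continuous_fst).inter
      ((isClosed_le continuous_const continuous_snd).inter
      ((isClosed_le continuous_const (continuous_fst.add continuous_snd)).inter
        (isClosed_le (continuous_fst.add continuous_snd) continuous_const)))
  · rintro ⟨s, t⟩ ⟨h1, h2, h3, h4⟩
    simp only at h1 h2 h3 h4
    -- The point (e, e) is interior, with coordinate sum midway between b and c. Moving towards it
    -- makes all four inequalities strict.
    set e := (b + c) / 4 with he
    have hlim : Tendsto (fun d : ℝ => (s + d * (e - s), t + d * (e - t))) (𝓝[>] 0) (𝓝 (s, t)) := by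
      have : Continuous fun d : ℝ => (s + d * (e - s), t + d * (e - t)) := by fun_prop
      have h0 := this.tendsto 0
      simp only [zero_mul, add_zero] at h0
      exact h0.mono_left nhdsWithin_le_nhds
    refine mem_closure_of_tendsto hlim ?_
    filter_upwards [Ioo_mem_nhdsGT one_pos] with d ⟨hd0, hd1⟩
    have he0 : 0 < e := by rw [he]; linarith
    have hd : 0 < 1 - d := by linarith
    have a1 := mul_nonneg hd.le h1
    have a2 := mul_nonneg hd.le h2
    have a3 := mul_nonneg hd.le (sub_nonneg.2 h3)
    have a4 := mul_nonneg hd.le (sub_nonneg.2 h4)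
    have a5 := mul_pos hd0 he0
    have a6 := mul_pos hd0 (sub_pos.2 hbc)
    have a7 : d * e = d * ((b + c) / 4) := by rw [he]
    refine ⟨?_, ?_, ?_, ?_⟩ <;> simp only <;> linarith

/-- The sides of the model trapezoid, as curves. -/
def trapezoidSide (b c : ℝ) : Fin 4 → ℝ → ℝ × ℝ :=
  ![fun t => (b + t * (c - b), 0), fun t => (0, b + t * (c - b)),
    fun t => (c * (1 - t), c * t), fun t => (b * (1 - t), b * t)]

theorem frontier_modelTrapezoid {b c : ℝ} (hb : 0 < b) (hbc : b < c) :
    frontier (modelTrapezoid b c) = ⋃ i, trapezoidSide b c i '' Icc 0 1 := by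
  have hc : 0 < c := hb.trans hbc
  have hd : 0 < c - b := sub_pos.2 hbc
  rw [(isOpen_modelTrapezoid b c).frontier_eq, closure_modelTrapezoid hb hbc]
  refine Subset.antisymm ?_ ?_
  · rintro ⟨s, t⟩ ⟨⟨h1, h2, h3, h4⟩, h5⟩
    simp only [modelTrapezoid, mem_ofPred_eq] at h1 h2 h3 h4 h5
    rw [mem_iUnion]
    by_cases ht : t = 0
    · subst ht
      refine ⟨0, (s - b) / (c - b), ⟨div_nonneg (by linarith) hd.le,
        (div_le_one hd).2 (by linarith)⟩, ?_⟩
      simp only [trapezoidSide, Matrix.cons_val_zero]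
      rw [div_mul_cancel₀ _ hd.ne', add_sub_cancel]
    by_cases hs : s = 0
    · subst hs
      refine ⟨1, (t - b) / (c - b), ⟨div_nonneg (by linarith) hd.le,
        (div_le_one hd).2 (by linarith)⟩, ?_⟩
      simp only [trapezoidSide, Matrix.cons_val_one, Matrix.cons_val_zero]
      rw [div_mul_cancel₀ _ hd.ne', add_sub_cancel]
    have hs' := lt_of_le_of_ne h1 (Ne.symm hs)
    have ht' := lt_of_le_of_ne h2 (Ne.symm ht)
    by_cases hsc : s + t = c
    · refine ⟨2, t / c, ⟨div_nonneg h2 hc.le, (div_le_one hc).2 (by linarith)⟩, ?_⟩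
      simp only [trapezoidSide, Matrix.cons_val]
      rw [mul_sub, mul_div_cancel₀ _ hc.ne', mul_one, ← hsc, add_sub_cancel_right]
    · have hsb : s + t = b := by
        by_contra hsb
        exact h5 ⟨hs', ht', lt_of_le_of_ne h3 (Ne.symm hsb), lt_of_le_of_ne h4 hsc⟩
      refine ⟨3, t / b, ⟨div_nonneg h2 hb.le, (div_le_one hb).2 (by linarith)⟩, ?_⟩
      simp only [trapezoidSide, Matrix.cons_val]
      rw [mul_sub, mul_div_cancel₀ _ hb.ne', mul_one, ← hsb, add_sub_cancel_right]
  · refine iUnion_subset fun i => ?_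
    rintro _ ⟨t, ⟨ht0, ht1⟩, rfl⟩
    have h1 := mul_nonneg ht0 hd.le
    have h2 := mul_le_mul_of_nonneg_right ht1 hd.le
    have h3 := mul_nonneg hc.le ht0
    have h4 := mul_nonneg hc.le (sub_nonneg.2 ht1)
    have h5 := mul_nonneg hb.le ht0
    have h6 := mul_nonneg hb.le (sub_nonneg.2 ht1)
    fin_cases i <;> simp only [trapezoidSide, modelTrapezoid, Set.mem_sdiff, mem_ofPred_eq,
      Fin.zero_eta, Fin.mk_one, Fin.reduceFinMk, Matrix.cons_val, Matrix.cons_val_zero,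
      Matrix.cons_val_one] <;>
      refine ⟨⟨by linarith, by linarith, by linarith, by linarith⟩, fun h => ?_⟩ <;>
      linarith [h.1, h.2.1, h.2.2.1, h.2.2.2]

theorem trapezoidSide_disjoint {b c : ℝ} (hb : 0 < b) (hbc : b < c) {i j : Fin 4} (hij : i ≠ j) :
    Disjoint (trapezoidSide b c i '' Ioo 0 1) (trapezoidSide b c j '' Icc 0 1) := by
  have hc : 0 < c := hb.trans hbc
  have hd : 0 < c - b := sub_pos.2 hbc
  rw [disjoint_left]
  rintro _ ⟨s, ⟨hs0, hs1⟩, rfl⟩ ⟨t, ⟨ht0, ht1⟩, h⟩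
  have h1 := mul_nonneg ht0 hd.le
  have h2 := mul_nonneg hc.le ht0
  have h3 := mul_nonneg hc.le (sub_nonneg.2 ht1)
  have h4 := mul_nonneg hb.le ht0
  have h5 := mul_nonneg hb.le (sub_nonneg.2 ht1)
  have h6 := mul_pos hs0 hd
  have h7 := mul_lt_mul_of_pos_right hs1 hd
  have h8 := mul_pos hc hs0
  have h9 := mul_pos hc (sub_pos.2 hs1)
  have h10 := mul_pos hb hs0
  have h11 := mul_pos hb (sub_pos.2 hs1)
  fin_cases i <;> fin_cases j <;> first
    | exact hij rfl
    | (simp only [trapezoidSide, Fin.zero_eta, Fin.mk_one, Fin.reduceFinMk, Matrix.cons_val,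
        Matrix.cons_val_zero, Matrix.cons_val_one, Prod.mk.injEq] at h
       obtain ⟨e1, e2⟩ := h
       linarith)

/-- The trapezoid cut out of a sector. -/
noncomputable def sectorTrapezoid (p : Plane) {α β : ℝ} (h : Real.sin (β - α) ≠ 0) (b c : ℝ) :
    Set Plane := obliqueCoordinates p h '' modelTrapezoid b c

theorem frontier_sectorTrapezoid (p : Plane) {α β : ℝ} (h : Real.sin (β - α) ≠ 0) {b c : ℝ}
    (hb : 0 < b) (hbc : b < c) : frontier (sectorTrapezoid p h b c) =
      ⋃ i, (fun t => obliqueCoordinates p h (trapezoidSide b c i t)) '' Icc 0 1 := by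
  rw [sectorTrapezoid, ← Homeomorph.image_frontier, frontier_modelTrapezoid hb hbc, image_iUnion]
  simp only [image_image]

theorem isSmoothArc_of_affine {A v : Plane} (hv : v ≠ 0) {γ : ℝ → Plane}
    (h : ∀ t, γ t = A + t • v) : IsSmoothArc γ := by
  obtain rfl : γ = fun t => A + t • v := funext h
  refine ⟨by fun_prop, fun t _ => ?_, fun s _ t _ hst => ?_⟩
  · have : HasDerivAt (fun t : ℝ => A + t • v) v t := by
      simpa using ((hasDerivAt_id t).smul_const v).const_add A
    rwa [this.deriv]
  · exact smul_left_injective ℝ hv (add_left_cancel hst)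

/-- The initial point and the velocity of the sides of a trapezoid in a sector. -/
theorem obliqueCoordinates_trapezoidSide (p : Plane) {α β : ℝ} (h : Real.sin (β - α) ≠ 0) (b c : ℝ)
    (i : Fin 4) (t : ℝ) : obliqueCoordinates p h (trapezoidSide b c i t) =
      (![p + b • planeDir α, p + b • planeDir β, p + c • planeDir α, p + b • planeDir α] i) +
      t • (![(c - b) • planeDir α, (c - b) • planeDir β, c • (planeDir β - planeDir α),
        b • (planeDir β - planeDir α)] i) := by
  fin_cases i <;> simp only [trapezoidSide, obliqueCoordinates_apply, Fin.zero_eta, Fin.mk_one,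
    Fin.reduceFinMk, Matrix.cons_val, Matrix.cons_val_zero, Matrix.cons_val_one] <;> module

theorem norm_planeDir_sub (α β : ℝ) (h0 : α ≤ β) (h1 : β ≤ α + 2 * Real.pi) :
    ‖planeDir β - planeDir α‖ = 2 * Real.sin ((β - α) / 2) := by
  have h2 : ‖planeDir β - planeDir α‖ ^ 2 = (2 * Real.sin ((β - α) / 2)) ^ 2 := by
    rw [norm_sub_sq_real, norm_planeDir, norm_planeDir, inner_planeDir, mul_pow, Real.sin_sq_eq_half_sub,
      show 2 * ((β - α) / 2) = β - α by ring, ← Real.cos_neg (α - β), neg_sub]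
    ring
  refine (sq_eq_sq₀ (norm_nonneg _) (mul_nonneg zero_le_two ?_)).1 h2
  exact Real.sin_nonneg_of_nonneg_of_le_pi (by linarith) (by linarith)

theorem planeLength_trapezoidSide (p : Plane) {α β : ℝ} (h : Real.sin (β - α) ≠ 0) (b c : ℝ)
    (i : Fin 4) :
    planeLength ((fun t => obliqueCoordinates p h (trapezoidSide b c i t)) '' Icc 0 1) =
      ‖(![(c - b) • planeDir α, (c - b) • planeDir β, c • (planeDir β - planeDir α),
        b • (planeDir β - planeDir α)] i : Plane)‖ₑ := by
  simp only [obliqueCoordinates_trapezoidSide]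
  generalize (![(c - b) • planeDir α, (c - b) • planeDir β, c • (planeDir β - planeDir α),
        b • (planeDir β - planeDir α)] i : Plane) = v
  generalize (![p + b • planeDir α, p + b • planeDir β, p + c • planeDir α,
    p + b • planeDir α] i : Plane) = A
  have : (fun t : ℝ => A + t • v) '' Icc 0 1 = segment ℝ A (A + v) := by
    rw [segment_eq_image']
    simp
  rw [planeLength, this, hausdorffMeasure_segment, edist_eq_enorm_sub, sub_add_cancel_left, enorm_neg]

theorem isAdmissible_sectorTrapezoid {M : Set Plane} (p : Plane) {α β : ℝ}
    (h : Real.sin (β - α) ≠ 0) {b c : ℝ} (hb : 0 < b) (hbc : b < c)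
    (hsub : sectorTrapezoid p h b c ⊆ M) : IsAdmissible M (sectorTrapezoid p h b c) := by
  have hne : planeDir β - planeDir α ≠ 0 := by
    intro h0
    rw [sub_eq_zero] at h0
    have h1 := congrArg (fun v : Plane => v 0) h0
    have h2 := congrArg (fun v : Plane => v 1) h0
    simp only [planeDir_zero, planeDir_one] at h1 h2
    rw [Real.sin_sub, h1, h2, mul_comm, sub_self] at h
    exact h rfl
  have hdir : ∀ φ, planeDir φ ≠ 0 := fun φ =>
    norm_ne_zero_iff.1 (by rw [norm_planeDir]; exact one_ne_zero)
  refine ⟨(obliqueCoordinates p h).isOpenMap _ (isOpen_modelTrapezoid b c), ?_, hsub, 4,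
    fun i t => obliqueCoordinates p h (trapezoidSide b c i t), fun i => ?_, fun i j hij => ?_,
    frontier_sectorTrapezoid p h hb hbc⟩
  · refine Nonempty.image _ ⟨((b + c) / 4, (b + c) / 4), ?_, ?_, ?_, ?_⟩ <;> simp only <;> linarith
  · refine isSmoothArc_of_affine ?_ (obliqueCoordinates_trapezoidSide p h b c i)
    have hc : c ≠ 0 := (hb.trans hbc).ne'
    have hd : c - b ≠ 0 := (sub_pos.2 hbc).ne'
    fin_cases i
    · exact smul_ne_zero hd (hdir α)
    · exact smul_ne_zero hd (hdir β)
    · exact smul_ne_zero hc hne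
    · exact smul_ne_zero hb.ne' hne
  · have := (disjoint_image_iff (obliqueCoordinates p h).injective).2
      (trapezoidSide_disjoint hb hbc hij)
    rwa [image_image, image_image] at this

/-- The isoperimetric ratio of a trapezoid whose legs lie on the boundary. -/
theorem isoperimetricRatio_sectorTrapezoid_le {M : Set Plane} (hM : IsOpen M) (p : Plane) {α β : ℝ}
    (h : Real.sin (β - α) ≠ 0) (hαβ : α ≤ β) (hβα : β ≤ α + 2 * Real.pi) {b c : ℝ} (hb : 0 < b)
    (hbc : b < c) (hα : ∀ s ∈ Icc b c, p + s • planeDir α ∈ frontier M)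
    (hβ : ∀ s ∈ Icc b c, p + s • planeDir β ∈ frontier M) :
    isoperimetricRatio M (sectorTrapezoid p h b c) ≤
      ENNReal.ofReal (Real.sin ((β - α) / 2) * (c + b) / (c - b)) := by
  -- Sides 0 and 1 are the legs, which lie on the frontier of M; sides 2 and 3 are the bases, of
  -- lengths 2cσ and 2bσ. Any part of the bases outside M only helps, so inequalities suffice.
  set side : Fin 4 → Set Plane := fun i =>
    (fun t => obliqueCoordinates p h (trapezoidSide b c i t)) '' Icc 0 1 with hside
  have hd : 0 < c - b := sub_pos.2 hbc
  have hc : 0 < c := hb.trans hbc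
  have hfr : frontier (sectorTrapezoid p h b c) = ⋃ i, side i := frontier_sectorTrapezoid p h hb hbc
  have hparam : ∀ t ∈ Icc (0 : ℝ) 1, b + t * (c - b) ∈ Icc b c := fun t ht =>
    ⟨by nlinarith [ht.1, ht.2], by nlinarith [ht.1, ht.2]⟩
  have h0 : side 0 ⊆ frontier M := by
    rintro _ ⟨t, ht, rfl⟩
    have := hα _ (hparam t ht)
    simpa [trapezoidSide, obliqueCoordinates_apply] using this
  have h1 : side 1 ⊆ frontier M := by
    rintro _ ⟨t, ht, rfl⟩
    have := hβ _ (hparam t ht)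
    simpa [trapezoidSide, obliqueCoordinates_apply] using this
  have hnot : ∀ x ∈ frontier M, x ∉ M := fun x hx => by
    rw [hM.frontier_eq] at hx; exact hx.2
  set σ := Real.sin ((β - α) / 2) with hσ
  have hσ0 : 0 ≤ σ := Real.sin_nonneg_of_nonneg_of_le_pi (by linarith) (by linarith)
  have hl2 : planeLength (side 2) = ENNReal.ofReal (2 * c * σ) := by
    rw [planeLength_trapezoidSide, ← ofReal_norm]
    simp only [Matrix.cons_val]
    rw [norm_smul, norm_planeDir_sub α β hαβ hβα, Real.norm_of_nonneg hc.le]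
    congr 1; ring
  have hl3 : planeLength (side 3) = ENNReal.ofReal (2 * b * σ) := by
    rw [planeLength_trapezoidSide, ← ofReal_norm]
    simp only [Matrix.cons_val]
    rw [norm_smul, norm_planeDir_sub α β hαβ hβα, Real.norm_of_nonneg hb.le]
    congr 1; ring
  have hl0 : planeLength (side 0) = ENNReal.ofReal (c - b) := by
    rw [planeLength_trapezoidSide, ← ofReal_norm]
    simp only [Matrix.cons_val]
    rw [norm_smul, norm_planeDir, Real.norm_of_nonneg hd.le, mul_one]
  have hl1 : planeLength (side 1) = ENNReal.ofReal (c - b) := by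
    rw [planeLength_trapezoidSide, ← ofReal_norm]
    simp only [Matrix.cons_val]
    rw [norm_smul, norm_planeDir, Real.norm_of_nonneg hd.le, mul_one]
  have hint : planeLength (interiorBoundary M (sectorTrapezoid p h b c)) ≤
      ENNReal.ofReal (2 * σ * (c + b)) := by
    have hsub : interiorBoundary M (sectorTrapezoid p h b c) ⊆ side 2 ∪ side 3 := by
      rintro x ⟨hx, hxM⟩
      rw [hfr, mem_iUnion] at hx
      obtain ⟨i, hi⟩ := hx
      fin_cases i
      · exact absurd hxM (hnot x (h0 hi))
      · exact absurd hxM (hnot x (h1 hi))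
      · exact Or.inl hi
      · exact Or.inr hi
    calc planeLength (interiorBoundary M (sectorTrapezoid p h b c))
        ≤ planeLength (side 2) + planeLength (side 3) :=
          (measure_mono hsub).trans (measure_union_le _ _)
      _ = _ := by
          rw [hl2, hl3, ← ENNReal.ofReal_add (by positivity) (by positivity)]
          congr 1; ring
  have hext : ENNReal.ofReal (2 * (c - b)) ≤
      planeLength (exteriorBoundary M (sectorTrapezoid p h b c)) := by
    have hsub : side 0 ∪ side 1 ⊆ exteriorBoundary M (sectorTrapezoid p h b c) := by
      refine union_subset (fun x hx => ⟨?_, h0 hx⟩) fun x hx => ⟨?_, h1 hx⟩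
      · rw [hfr]; exact mem_iUnion.2 ⟨0, hx⟩
      · rw [hfr]; exact mem_iUnion.2 ⟨1, hx⟩
    have hdisj : Disjoint (side 0) (side 1) := by
      rw [disjoint_left]
      rintro _ ⟨s, hs, rfl⟩ ⟨t, ht, hst⟩
      have := (obliqueCoordinates p h).injective hst
      simp only [trapezoidSide, Matrix.cons_val_zero, Matrix.cons_val_one, Prod.mk.injEq] at this
      linarith [(hparam s hs).1, this.1]
    have hcl : MeasurableSet (side 1) := by
      refine (isCompact_Icc.image ?_).isClosed.measurableSet
      refine (obliqueCoordinates p h).continuous.comp ?_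
      simp only [trapezoidSide, Matrix.cons_val_one, Matrix.cons_val_zero]
      fun_prop
    calc ENNReal.ofReal (2 * (c - b)) = planeLength (side 0) + planeLength (side 1) := by
          rw [hl0, hl1, ← ENNReal.ofReal_add hd.le hd.le, two_mul]
      _ = planeLength (side 0 ∪ side 1) := (measure_union hdisj hcl).symm
      _ ≤ _ := measure_mono hsub
  have hpos : 0 < ENNReal.ofReal (2 * (c - b)) := ENNReal.ofReal_pos.2 (by linarith)
  rw [isoperimetricRatio, if_neg (hpos.trans_le hext).ne']
  calc _ ≤ ENNReal.ofReal (2 * σ * (c + b)) / ENNReal.ofReal (2 * (c - b)) :=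
        ENNReal.div_le_div hint hext
    _ = ENNReal.ofReal (2 * σ * (c + b) / (2 * (c - b))) :=
        (ENNReal.ofReal_div_of_pos (by linarith)).symm
    _ = _ := by
        congr 1
        field_simp

/-- A domain that contains a sector whose legs lie on the boundary has Escobar constants at most the
sine of half the angle of the sector. -/
theorem escobarConstant_le_of_sector {M : Set Plane} (hM : IsOpen M) {p : Plane} {α β ρ : ℝ}
    (hαβ : α < β) (hβα : β < α + Real.pi) (hρ : 0 < ρ)
    (hsec : ∀ φ ∈ Ioo α β, ∀ s ∈ Ioo 0 ρ, p + s • planeDir φ ∈ M)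
    (hα : ∀ s ∈ Ioo 0 ρ, p + s • planeDir α ∈ frontier M)
    (hβ : ∀ s ∈ Ioo 0 ρ, p + s • planeDir β ∈ frontier M) (k : ℕ) :
    escobarConstant k M ≤ ENNReal.ofReal (Real.sin ((β - α) / 2)) := by
  have hπ := Real.pi_pos
  have hsinpos : 0 < Real.sin (β - α) := Real.sin_pos_of_pos_of_lt_pi (by linarith) (by linarith)
  have h := hsinpos.ne'
  have hsub : ∀ b c, 0 < b → c < ρ → sectorTrapezoid p h b c ⊆ M := by
    rintro b c hb hc _ ⟨⟨s, t⟩, ⟨h1, h2, h3, h4⟩, rfl⟩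
    simp only at h1 h2 h3 h4
    rw [obliqueCoordinates_apply, add_assoc]
    set w := s • planeDir α + t • planeDir β with hw
    obtain ⟨φ, hφ, hwφ⟩ := exists_eq_norm_smul_planeDir w α
    have hwn : ‖w‖ < ρ := by
      refine (norm_add_le _ _).trans_lt ?_
      rw [norm_smul, norm_smul, norm_planeDir, norm_planeDir, Real.norm_of_nonneg h1.le,
        Real.norm_of_nonneg h2.le]
      linarith
    have hw0 := congrArg (fun v : Plane => v 0) hwφ
    have hw1 := congrArg (fun v : Plane => v 1) hwφ
    have e0 : w 0 = s * Real.cos α + t * Real.cos β := by simp [hw]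
    have e1 : w 1 = s * Real.sin α + t * Real.sin β := by simp [hw]
    simp only [PiLp.smul_apply, planeDir_zero, planeDir_one, smul_eq_mul] at hw0 hw1
    -- Cross products of w with the two axes. Both sines are positive for positive coordinates,
    -- which forces the polar angle of w strictly between α and β.
    have hc1 : ‖w‖ * Real.sin (φ - α) = t * Real.sin (β - α) := by
      rw [Real.sin_sub, Real.sin_sub]
      linear_combination (Real.sin α) * hw0 - (Real.cos α) * hw1 - (Real.sin α) * e0 +
        (Real.cos α) * e1
    have hc2 : ‖w‖ * Real.sin (β - φ) = s * Real.sin (β - α) := by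
      rw [Real.sin_sub, Real.sin_sub]
      linear_combination -(Real.sin β) * hw0 + (Real.cos β) * hw1 + (Real.sin β) * e0 -
        (Real.cos β) * e1
    have hpos : ∀ {x y : ℝ}, 0 < y → ‖w‖ * x = y * Real.sin (β - α) → 0 < x := by
      intro x y hy hxy
      by_contra! hx
      have := mul_nonpos_of_nonneg_of_nonpos (norm_nonneg w) hx
      have := mul_pos hy hsinpos
      linarith
    have hs1 := hpos h2 hc1
    have hs2 := hpos h1 hc2
    have hφπ : φ < α + Real.pi := by
      by_contra! hge
      have := Real.sin_nonneg_of_nonneg_of_le_pi (x := φ - α - Real.pi) (by linarith)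
        (by linarith [hφ.2])
      rw [Real.sin_sub_pi] at this
      linarith
    have hφβ : φ < β := by
      by_contra! hge
      have := Real.sin_nonpos_of_nonpos_of_neg_pi_le (x := β - φ) (by linarith) (by linarith)
      linarith
    have hwpos : 0 < ‖w‖ := by
      refine lt_of_le_of_ne (norm_nonneg w) fun h0 => ?_
      rw [← h0, zero_mul] at hc1
      exact (mul_pos h2 hsinpos).ne hc1
    rw [hwφ]
    exact hsec φ ⟨hφ.1, hφβ⟩ ‖w‖ ⟨hwpos, hwn⟩
  set σ := Real.sin ((β - α) / 2) with hσ
  have key : ∀ ε ∈ Ioo (0 : ℝ) 1,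
      escobarConstant k M ≤ ENNReal.ofReal (σ * (1 + ε) / (1 - ε)) := by
    rintro ε ⟨hε0, hε1⟩
    have hr : 0 < ρ / 2 := half_pos hρ
    have hpow : ∀ j : ℕ, 0 < ρ / 2 * ε ^ j := fun j => by positivity
    have hlt : ∀ j : ℕ, ρ / 2 * ε ^ (j + 1) < ρ / 2 * ε ^ j := fun j => by
      rw [pow_succ]
      have := mul_pos (hpow j) (sub_pos.2 hε1)
      linarith
    have hle : ∀ j : ℕ, ρ / 2 * ε ^ j < ρ := fun j => by
      have : ε ^ j ≤ 1 := pow_le_one₀ hε0.le hε1.le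
      nlinarith
    -- Consecutive scales ρ/2 · εʲ make the trapezoids adjacent but disjoint, all with the same
    -- ratio b/c = ε, so the bound does not depend on k.
    refine iInf₂_le_of_le (fun j : Fin k =>
      sectorTrapezoid p h (ρ / 2 * ε ^ ((j : ℕ) + 1)) (ρ / 2 * ε ^ (j : ℕ)))
      ⟨fun j => isAdmissible_sectorTrapezoid p h (hpow _) (hlt _) (hsub _ _ (hpow _) (hle _)), ?_⟩ ?_
    · have hlt' : ∀ i j : Fin k, i < j →
          Disjoint (modelTrapezoid (ρ / 2 * ε ^ ((i : ℕ) + 1)) (ρ / 2 * ε ^ (i : ℕ)))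
            (modelTrapezoid (ρ / 2 * ε ^ ((j : ℕ) + 1)) (ρ / 2 * ε ^ (j : ℕ))) := by
        intro i j hij
        rw [disjoint_left]
        intro q hqi hqj
        have h1 : ρ / 2 * ε ^ (j : ℕ) ≤ ρ / 2 * ε ^ ((i : ℕ) + 1) :=
          mul_le_mul_of_nonneg_left (pow_le_pow_of_le_one hε0.le hε1.le hij) hr.le
        linarith [hqi.2.2.1, hqj.2.2.2]
      intro i j hij
      refine (disjoint_image_iff (obliqueCoordinates p h).injective).2 ?_
      rcases lt_or_gt_of_ne hij with hlt2 | hlt2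
      · exact hlt' i j hlt2
      · exact (hlt' j i hlt2).symm
    · refine iSup_le fun j => ?_
      refine (isoperimetricRatio_sectorTrapezoid_le hM p h hαβ.le (by linarith) (hpow _) (hlt _)
        (fun s hs => hα s ⟨(hpow _).trans_le hs.1, hs.2.trans_lt (hle _)⟩)
        (fun s hs => hβ s ⟨(hpow _).trans_le hs.1, hs.2.trans_lt (hle _)⟩)).trans_eq ?_
      congr 1
      have hne : 1 - ε ≠ 0 := by linarith
      have h1 := (hpow j).ne'
      rw [show ρ / 2 * ε ^ (j : ℕ) + ρ / 2 * ε ^ ((j : ℕ) + 1) =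
        (ρ / 2 * ε ^ (j : ℕ)) * (1 + ε) by ring, show ρ / 2 * ε ^ (j : ℕ) -
        ρ / 2 * ε ^ ((j : ℕ) + 1) = (ρ / 2 * ε ^ (j : ℕ)) * (1 - ε) by ring,
        mul_left_comm, mul_div_mul_left _ _ h1]
  have hlim : Tendsto (fun ε : ℝ => ENNReal.ofReal (σ * (1 + ε) / (1 - ε))) (𝓝[>] 0)
      (𝓝 (ENNReal.ofReal σ)) := by
    have : ContinuousAt (fun ε : ℝ => σ * (1 + ε) / (1 - ε)) 0 :=
      ContinuousAt.div (by fun_prop) (by fun_prop) (by norm_num)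
    have h0 := (ENNReal.continuous_ofReal.continuousAt.comp this).tendsto
    simp only [Function.comp_apply, add_zero, mul_one, sub_zero, div_one] at h0
    exact h0.mono_left nhdsWithin_le_nhds
  refine ge_of_tendsto hlim ?_
  filter_upwards [Ioo_mem_nhdsGT one_pos] with ε hε using key ε hε

/-! ### The domain near a vertex -/

theorem mem_segment_add_smul_planeDir {p : Plane} {L φ : ℝ} (hL : 0 < L) {x : Plane}
    (hx : x ∈ affineSegment ℝ p (p + L • planeDir φ)) :
    ∃ s ∈ Icc 0 L, x = p + s • planeDir φ := by
  obtain ⟨t, ht, rfl⟩ := hx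
  refine ⟨t * L, ⟨mul_nonneg ht.1 hL.le, by nlinarith [ht.2]⟩, ?_⟩
  rw [AffineMap.lineMap_apply_module]
  module

theorem add_smul_planeDir_mem_segment {p : Plane} {L φ s : ℝ} (hL : 0 < L) (hs : s ∈ Icc 0 L) :
    p + s • planeDir φ ∈ affineSegment ℝ p (p + L • planeDir φ) := by
  refine ⟨s / L, ⟨div_nonneg hs.1 hL.le, (div_le_one hL).2 hs.2⟩, ?_⟩
  rw [AffineMap.lineMap_apply_module]
  have : s = s / L * L := (div_mul_cancel₀ _ hL.ne').symm
  conv_rhs => rw [this]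
  module

/-- Near each vertex, the boundary of a simple polygon consists of two rays. -/
theorem IsEuclideanPolygon.exists_local_rays {n : ℕ} {P : Polygon Plane n} {M : Set Plane}
    (hM : IsEuclideanPolygon P M) (i : Fin n) :
    ∃ a b ρ : ℝ, a < b ∧ b < a + 2 * Real.pi ∧ 0 < ρ ∧
      (∀ s ∈ Ico 0 ρ, P i + s • planeDir a ∈ frontier M ∧ P i + s • planeDir b ∈ frontier M) ∧
      ∀ φ, ∀ s ∈ Ioo 0 ρ, P i + s • planeDir φ ∈ frontier M →
        planeDir φ = planeDir a ∨ planeDir φ = planeDir b := by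
  have hn := hM.simple.three_le
  have hinj := hM.simple.injective
  set i' := (finRotate n).symm i with hi'
  have hroti' : finRotate n i' = i := Equiv.apply_symm_apply _ _
  have hrot : ∀ j : Fin n, finRotate n j ≠ j := by
    intro j
    obtain ⟨m, rfl⟩ : ∃ m, n = m + 2 := ⟨n - 2, by lia⟩
    have : j ∈ (finRotate (m + 2)).support := by rw [support_finRotate]; exact Finset.mem_univ j
    exact Equiv.Perm.mem_support.1 this
  set p := P i with hp
  set u := P (finRotate n i) - p with hu
  set v := P i' - p with hv
  have hu0 : u ≠ 0 := sub_ne_zero.2 fun h => hrot i (hinj h)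
  have hv0 : v ≠ 0 := sub_ne_zero.2 fun h => hrot i' (by rw [hroti']; exact (hinj h).symm)
  have hun : 0 < ‖u‖ := norm_pos_iff.2 hu0
  have hvn : 0 < ‖v‖ := norm_pos_iff.2 hv0
  obtain ⟨a, -, ha⟩ := exists_eq_norm_smul_planeDir u 0
  obtain ⟨b, hb, hbv⟩ := exists_eq_norm_smul_planeDir v a
  have hedge : P.edgeSet ℝ i = affineSegment ℝ p (p + ‖u‖ • planeDir a) := by
    rw [← ha, hu, add_sub_cancel]; rfl
  have hedge' : P.edgeSet ℝ i' = affineSegment ℝ p (p + ‖v‖ • planeDir b) := by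
    rw [← hbv, hv, add_sub_cancel, affineSegment_comm, Polygon.edgeSet, hroti']
  -- If both edges left the vertex in the same direction, they would share more than the vertex.
  have hbne : b ≠ a + 2 * Real.pi := by
    intro h
    have hdir : planeDir b = planeDir a := by rw [h, planeDir_add_two_pi]
    have hm : 0 < min ‖u‖ ‖v‖ := lt_min hun hvn
    have h1 : p + min ‖u‖ ‖v‖ • planeDir a ∈ P.edgeSet ℝ i' ∩ P.edgeSet ℝ (finRotate n i') := by
      rw [hroti', hedge, hedge', hdir]
      exact ⟨add_smul_planeDir_mem_segment hvn ⟨hm.le, min_le_right _ _⟩,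
        add_smul_planeDir_mem_segment hun ⟨hm.le, min_le_left _ _⟩⟩
    rw [hM.simple.adjacent i', hroti', mem_singleton_iff, ← hp, add_eq_left] at h1
    have h2 := congrArg norm h1
    rw [norm_smul, norm_planeDir, norm_zero, mul_one, Real.norm_of_nonneg hm.le] at h2
    exact hm.ne' h2
  have hother : ∀ j, j ≠ i → j ≠ i' → p ∉ P.edgeSet ℝ j := by
    intro j hji hji' hpj
    have hpi : p ∈ P.edgeSet ℝ i := by rw [hedge]; exact left_mem_affineSegment ℝ _ _
    by_cases hj : finRotate n i = j
    · have h1 : p ∈ P.edgeSet ℝ i ∩ P.edgeSet ℝ (finRotate n i) := ⟨hpi, by rwa [hj]⟩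
      rw [hM.simple.adjacent i, mem_singleton_iff] at h1
      exact hrot i (hinj h1).symm
    · refine disjoint_left.1 (hM.simple.nonadjacent i j (Ne.symm hji) hj ?_) hpi hpj
      intro h
      exact hji' (by rw [hi', ← h, Equiv.symm_apply_apply])
  have hclosed : ∀ j, IsClosed (P.edgeSet ℝ j) := fun j => by
    rw [Polygon.edgeSet_eq_image_edgePath]
    exact (isCompact_Icc.image (AffineMap.lineMap_continuous)).isClosed
  have hfar : ∀ᶠ x in 𝓝 p, ∀ j, j ≠ i → j ≠ i' → x ∉ P.edgeSet ℝ j := by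
    refine eventually_all.2 fun j => ?_
    by_cases h1 : j = i
    · simp [h1]
    by_cases h2 : j = i'
    · simp [h2]
    filter_upwards [(hclosed j).isOpen_compl.mem_nhds (hother j h1 h2)] with x hx _ _ using hx
  obtain ⟨δ, hδ, hball⟩ := Metric.eventually_nhds_iff.1 hfar
  have hsub : ∀ j, P.edgeSet ℝ j ⊆ frontier M := fun j => by
    rw [hM.frontier_eq]; exact subset_iUnion (fun j => P.edgeSet ℝ j) j
  have hdirinj : ∀ {s t φ ψ : ℝ}, 0 < s → 0 ≤ t → s • planeDir φ = t • planeDir ψ →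
      planeDir φ = planeDir ψ := by
    intro s t φ ψ hs ht h
    have h1 := congrArg norm h
    rw [norm_smul, norm_smul, norm_planeDir, norm_planeDir, mul_one, mul_one,
      Real.norm_of_nonneg hs.le, Real.norm_of_nonneg ht] at h1
    rw [← h1] at h
    exact smul_right_injective Plane hs.ne' h
  refine ⟨a, b, min δ (min ‖u‖ ‖v‖), hb.1, lt_of_le_of_ne hb.2 hbne, by positivity, ?_, ?_⟩
  · rintro s ⟨hs0, hs⟩
    have h1 : s ≤ ‖u‖ := hs.le.trans ((min_le_right _ _).trans (min_le_left _ _))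
    have h2 : s ≤ ‖v‖ := hs.le.trans ((min_le_right _ _).trans (min_le_right _ _))
    refine ⟨hsub i ?_, hsub i' ?_⟩
    · rw [hedge]; exact add_smul_planeDir_mem_segment hun ⟨hs0, h1⟩
    · rw [hedge']; exact add_smul_planeDir_mem_segment hvn ⟨hs0, h2⟩
  · rintro φ s ⟨hs0, hs⟩ hf
    have hd : dist (p + s • planeDir φ) p < δ := by
      rw [dist_eq_norm, add_sub_cancel_left, norm_smul, norm_planeDir, mul_one,
        Real.norm_of_nonneg hs0.le]
      exact hs.trans_le (min_le_left _ _)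
    rw [hM.frontier_eq, Polygon.boundary, mem_iUnion] at hf
    obtain ⟨j, hj⟩ := hf
    by_cases hji : j = i
    · rw [hji, hedge] at hj
      obtain ⟨t, ht, hst⟩ := mem_segment_add_smul_planeDir hun hj
      exact Or.inl (hdirinj hs0 ht.1 (add_left_cancel hst))
    by_cases hji' : j = i'
    · rw [hji', hedge'] at hj
      obtain ⟨t, ht, hst⟩ := mem_segment_add_smul_planeDir hvn hj
      exact Or.inr (hdirinj hs0 ht.1 (add_left_cancel hst))
    · exact absurd hj (hball hd j hji hji')

/-- A domain that contains a sector at a point has interior angle there at least that of the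
sector. -/
theorem sub_le_interiorAngle {M : Set Plane} {p : Plane} {α β ρ : ℝ} (hρ : 0 < ρ)
    (hβα : β ≤ α + 2 * Real.pi) (hsec : ∀ φ ∈ Ioo α β, ∀ s ∈ Ioo 0 ρ, p + s • planeDir φ ∈ M) :
    β - α ≤ interiorAngle M p := by
  -- The interval (α, β) may stick out of (-π, π], where interior angles are measured; its periodic
  -- extension has the same measure in every window of length 2π.
  set T : Set ℝ := ⋃ k : ℤ, (fun x : ℝ => x + k * (2 * Real.pi)) ⁻¹' Ioo α β with hT
  have hTm : MeasurableSet T := MeasurableSet.iUnion fun k =>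
    measurableSet_Ioo.preimage (by fun_prop)
  have hTp : ∀ (k : ℤ) (x : ℝ), x + k * (2 * Real.pi) ∈ T ↔ x ∈ T := by
    intro k x
    simp only [hT, mem_iUnion, mem_preimage]
    constructor
    · rintro ⟨l, hl⟩
      exact ⟨k + l, by push_cast; rwa [add_mul, ← add_assoc]⟩
    · rintro ⟨l, hl⟩
      refine ⟨l - k, ?_⟩
      push_cast
      rwa [show x + k * (2 * Real.pi) + (l - k) * (2 * Real.pi) = x + l * (2 * Real.pi) by ring]
  have h1 : ENNReal.ofReal (β - α) ≤ volume (T ∩ Ioc (-Real.pi) Real.pi) := by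
    rw [volume_inter_Ioc_eq_of_periodic hTm hTp α, ← Real.volume_Ioo]
    refine measure_mono fun x hx => ⟨mem_iUnion.2 ⟨0, by simpa using hx⟩, hx.1, hx.2.le.trans hβα⟩
  have h2 : T ∩ Ioc (-Real.pi) Real.pi ⊆ {φ : ℝ | φ ∈ Ioc (-Real.pi) Real.pi ∧
      ∃ r > 0, ∀ s ∈ Ioo (0 : ℝ) r, p + s • !₂[Real.cos φ, Real.sin φ] ∈ M} := by
    rintro φ ⟨hφT, hφ⟩
    obtain ⟨k, hk⟩ := mem_iUnion.1 hφT
    refine ⟨hφ, ρ, hρ, fun s hs => ?_⟩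
    have := hsec _ hk s hs
    rwa [planeDir_add_int_mul_two_pi] at this
  refine (ENNReal.ofReal_le_iff_le_toReal ?_).1 (h1.trans (measure_mono h2))
  exact ne_top_of_le_ne_top (measure_Ioc_lt_top (a := -Real.pi) (b := Real.pi)).ne
    (measure_mono fun φ hφ => hφ.1)

/-- An open sector that avoids the frontier lies in the domain or in its complement. -/
theorem sector_subset_or_disjoint {M : Set Plane} (hM : IsOpen M) {p : Plane} {α β ρ : ℝ}
    (hf : ∀ φ ∈ Ioo α β, ∀ s ∈ Ioo 0 ρ, p + s • planeDir φ ∉ frontier M) :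
    (∀ φ ∈ Ioo α β, ∀ s ∈ Ioo 0 ρ, p + s • planeDir φ ∈ M) ∨
      ∀ φ ∈ Ioo α β, ∀ s ∈ Ioo 0 ρ, p + s • planeDir φ ∉ M := by
  set S : Set Plane := (fun q : ℝ × ℝ => p + q.2 • planeDir q.1) '' (Ioo α β ×ˢ Ioo 0 ρ) with hS
  have hpre : IsPreconnected S := by
    refine (isPreconnected_Ioo.prod isPreconnected_Ioo).image _ (Continuous.continuousOn ?_)
    exact continuous_const.add (continuous_snd.smul (continuous_planeDir.comp continuous_fst))
  have hd : Disjoint S (frontier M) := by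
    rw [disjoint_left]
    rintro _ ⟨q, hq, rfl⟩
    exact hf _ hq.1 _ hq.2
  have hmem : ∀ φ ∈ Ioo α β, ∀ s ∈ Ioo 0 ρ, p + s • planeDir φ ∈ S := fun φ hφ s hs =>
    ⟨(φ, s), ⟨hφ, hs⟩, rfl⟩
  by_cases h : (S ∩ M).Nonempty
  · exact Or.inl fun φ hφ s hs => hpre.subset_of_disjoint_frontier hM hd h (hmem φ hφ s hs)
  · exact Or.inr fun φ hφ s hs hm => h ⟨_, hmem φ hφ s hs, hm⟩

/-- At each vertex, a polygonal domain contains a sector whose legs lie on the boundary. -/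
theorem IsEuclideanPolygon.exists_sector {n : ℕ} {P : Polygon Plane n} {M : Set Plane}
    (hM : IsEuclideanPolygon P M) (i : Fin n) :
    ∃ α β ρ : ℝ, α < β ∧ β ≤ α + 2 * Real.pi ∧ 0 < ρ ∧
      (∀ φ ∈ Ioo α β, ∀ s ∈ Ioo 0 ρ, P i + s • planeDir φ ∈ M) ∧
      (∀ s ∈ Ioo 0 ρ, P i + s • planeDir α ∈ frontier M) ∧
      ∀ s ∈ Ioo 0 ρ, P i + s • planeDir β ∈ frontier M := by
  obtain ⟨a, b, ρ, hab, hba, hρ, hrays, hlocal⟩ := hM.exists_local_rays i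
  have hπ := Real.pi_pos
  have ha' := planeDir_add_two_pi a
  have hsub : ∀ s ∈ Ioo 0 ρ, s ∈ Ico 0 ρ := fun s hs => Ioo_subset_Ico_self hs
  have hf1 : ∀ φ ∈ Ioo a b, ∀ s ∈ Ioo 0 ρ, P i + s • planeDir φ ∉ frontier M := by
    intro φ hφ s hs hf
    rcases hlocal φ s hs hf with h | h
    · exact planeDir_ne_of_lt_of_lt hφ.1 (by linarith [hφ.2]) h.symm
    · exact planeDir_ne_of_lt_of_lt hφ.2 (by linarith [hφ.1]) h
  have hf2 : ∀ φ ∈ Ioo b (a + 2 * Real.pi), ∀ s ∈ Ioo 0 ρ,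
      P i + s • planeDir φ ∉ frontier M := by
    intro φ hφ s hs hf
    rcases hlocal φ s hs hf with h | h
    · exact planeDir_ne_of_lt_of_lt (hab.trans hφ.1) (by linarith [hφ.2]) h.symm
    · exact planeDir_ne_of_lt_of_lt hφ.1 (by linarith [hφ.2]) h.symm
  rcases sector_subset_or_disjoint hM.isOpen hf1 with h1 | h1
  · exact ⟨a, b, ρ, hab, hba.le, hρ, h1, fun s hs => (hrays s (hsub s hs)).1,
      fun s hs => (hrays s (hsub s hs)).2⟩
  rcases sector_subset_or_disjoint hM.isOpen hf2 with h2 | h2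
  · exact ⟨b, a + 2 * Real.pi, ρ, hba, by linarith, hρ, h2, fun s hs => (hrays s (hsub s hs)).2,
      fun s hs => by rw [ha']; exact (hrays s (hsub s hs)).1⟩
  -- If both complementary sectors avoided M, a punctured disk around the vertex would miss M,
  -- although the vertex lies in the closure of M.
  exfalso
  have hp : P i ∈ frontier M := by simpa using (hrays 0 ⟨le_rfl, hρ⟩).1
  have hnot : ∀ x ∈ frontier M, x ∉ M := fun x hx => by
    rw [hM.isOpen.frontier_eq] at hx; exact hx.2
  obtain ⟨x, hxM, hx⟩ := Metric.mem_closure_iff.1 (frontier_subset_closure hp) ρ hρ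
  obtain ⟨φ, hφ, hxφ⟩ := exists_eq_norm_smul_planeDir (x - P i) a
  have hx0 : 0 < ‖x - P i‖ := norm_pos_iff.2 (sub_ne_zero.2 fun h => hnot _ hp (by rwa [← h]))
  have hxρ : ‖x - P i‖ < ρ := by rwa [← dist_eq_norm, dist_comm]
  have hxe : x = P i + ‖x - P i‖ • planeDir φ := by rw [← hxφ, add_sub_cancel]
  rw [hxe] at hxM
  have hs : ‖x - P i‖ ∈ Ioo 0 ρ := ⟨hx0, hxρ⟩
  rcases lt_trichotomy φ b with h | h | h
  · exact h1 φ ⟨hφ.1, h⟩ _ hs hxM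
  · rw [h] at hxM
    exact hnot _ (hrays _ (hsub _ hs)).2 hxM
  · rcases hφ.2.eq_or_lt with h' | h'
    · rw [h', ha'] at hxM
      exact hnot _ (hrays _ (hsub _ hs)).1 hxM
    · exact h2 φ ⟨h, h'⟩ _ hs hxM

/-! ### The theorem -/

theorem theorem1p4 (n : ℕ) (P : Polygon Plane n) (M : Set Plane)
    (hM : IsEuclideanPolygon P M)
    (θ₁ : ℝ) (hθ₁ : IsLeast (Set.range fun i : Fin n => interiorAngle M (P i)) θ₁) :
    (∀ k : ℕ, 3 ≤ k →
      escobarConstant k M ≤ ENNReal.ofReal (Real.sin (θ₁ / 2)) ∧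
      Real.sin (θ₁ / 2) ≤ Real.cos (Real.pi / n)) ∧
    (∀ k : ℕ, 3 ≤ k → (n ≤ k ∨ n ≤ 4) →
      escobarConstant k M ≤ escobarConstant k unitDisk) := by
  have hπ := Real.pi_pos
  have hn := hM.simple.three_le
  have hn0 : (0 : ℝ) < n := by exact_mod_cast (by lia : 0 < n)
  obtain ⟨⟨i, rfl⟩, hmin⟩ := hθ₁
  simp only
  set θ := interiorAngle M (P i) with hθ
  have hθ0 : 0 ≤ θ := ENNReal.toReal_nonneg
  have hθle : θ ≤ Real.pi - 2 * Real.pi / n := by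
    obtain ⟨j, hj⟩ := hM.exists_interiorAngle_le
    exact (hmin ⟨j, rfl⟩).trans hj
  -- The least angle is convex. This is needed both for the trapezoids, which require a sector of
  -- angle less than π, and for the sine to be increasing on the half-angles.
  have hθπ : θ < Real.pi := by
    have : 0 < 2 * Real.pi / n := by positivity
    linarith
  have hcos : Real.sin (θ / 2) ≤ Real.cos (Real.pi / n) := by
    rw [← Real.sin_pi_div_two_sub]
    have h1 : 2 * Real.pi / n = 2 * (Real.pi / n) := by ring
    refine Real.sin_le_sin_of_le_of_le_pi_div_two (by linarith) ?_ (by linarith)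
    linarith [div_pos hπ hn0]
  have hesc : ∀ k, escobarConstant k M ≤ ENNReal.ofReal (Real.sin (θ / 2)) := by
    intro k
    obtain ⟨α, β, ρ, hαβ, hβα, hρ, hsec, hα, hβ⟩ := hM.exists_sector i
    -- Only this inequality between sector and interior angle is used; that the sector exhausts the
    -- angle need not be known.
    have hle := sub_le_interiorAngle hρ hβα hsec
    refine (escobarConstant_le_of_sector hM.isOpen hαβ (by linarith) hρ hsec hα hβ k).trans ?_
    refine ENNReal.ofReal_le_ofReal ?_
    exact Real.sin_le_sin_of_le_of_le_pi_div_two (by linarith) (by linarith) (by linarith)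
  refine ⟨fun k _ => ⟨hesc k, hcos⟩, fun k hk hnk => ?_⟩
  exact (hesc k).trans ((ENNReal.ofReal_le_ofReal hcos).trans
    (cos_pi_div_le_escobarConstant_unitDisk hn hk hnk))
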